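/- **Setting.** Let $n\ge 1$ and let $\Omega\subset\mathbb R^n$ be bounded and open. For $m\in\mathbb N$, $m\ge 1$, set $m\Omega=\{x: m^{-1}x\in\Omega\}$. For $B\subset\mathbb Z^n$ and $j\in\mathbb Z^n$ put $\tau_j(B)=B+j$. For $X:\mathbb Z^n\to\mathbb R^n$ let $\nabla_dX_i\in\mathbb R^{n\times n}$ be the matrix with columns $X_{i+e_b}-X_i$, $b=1,\dots,n$. For matrix fields $F,G$ on $\mathbb Z^n$ and a finite set $B\subset\mathbb Z^n$ put $\operatorname{dist}(F_i,G_i)|_{i\in B}=\max_{i\in B}|F_i-G_i|$ (Frobenius norm). Let $\Lambda\subset\mathbb Z^n$ be finite and let $h:(\mathbb R^{n\times n})^\Lambda\to[0,\infty)$ satisfy $h((RF_i)_{i\in\Lambda})=h((F_i)_{i\in\Lambda})$ for all $R\in SO(n)$. The Hamiltonians are $$H_m(X)=m^{-n}\sum_{j\in\mathbb Z^n:\ \tau_j(\Lambda)\subset m\Omega}h\big((\nabla_dX_{j+i})_{i\in\Lambda}\big).$$ **(H1)** There are $Z_1,\dots,Z_k:\mathbb Z^n\to\mathbb R^n$ such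 that: (a) $\nabla_dZ_l$ is periodic with a rectangular period cell $Q_l=\prod_{a=1}^n\{0,\dots,T_{l,a}-1\}$, $T_{l,a}\ge1$. Put $L_0=\max_l\operatorname{diam}(Q_l)$ (Euclidean diameter) and $Q_0=[0,L_0]^n\cap\mathbb Z^n$. (b) $\sum_{j\in\mathbb Z^n}h((\nabla_dX_{j+i})_{i\in\Lambda})=0$ if and only if there are $l\in\{1,\dots,k\}$, $R\in SO(n)$ and $b\in\mathbb R^n$ with $X_j=RZ_{l,j}+b$ for all $j\in\mathbb Z^n$. (c) The averages $U_l=|Q_l|^{-1}\sum_{i\in Q_l}\nabla_dZ_{l,i}$ are invertible. (d) There is $d>0$ such that $\operatorname{dist}(R_1\nabla_dZ_{l_1,i},R_2\nabla_dZ_{l_2,i})|_{i\in Q_0}\ge d$ for all $l_1\ne l_2$ and all $R_1,R_2\in SO(n)$. **(H2)** There are $p\in(1,\infty)$, $c>0$ and a box $\tilde\Lambda\subset\mathbb Z^n$ containing $\Lambda$ and $[0,2L_0]^n\cap\mathbb Z^n$ such that for all $m\ge1$, all $j_0\in\mathbb Z^n$ with $\tau_{j_0}(\tilde\Lambda)\subset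 m\Omega$, all $X:\mathbb Z^n\to\mathbb R^n$ and all $\kappa\ge0$: if $\operatorname{dist}(R\nabla_dZ_{l,i},\nabla_dX_i)|_{i\in\tilde\Lambda+j_0}\ge\kappa$ for all $l\in\{1,\dots,k\}$ and all $R\in SO(n)$, then $$\sum_{j:\ \tau_j(\Lambda)\subset\tilde\Lambda+j_0}h\big((\nabla_dX_{j+i})_{i\in\Lambda}\big)\ge c\,\kappa^p.$$ **Proposition.** Assume (H1) and (H2), and let $X_m:\mathbb Z^n\to\mathbb R^n$ satisfy $H_m(X_m)\le C m^{-1}$ for all $m\ge1$, with $C$ independent of $m$. For $l\in\{1,\dots,k\}$ set $$\begin{aligned} \Omega_{l,m}&=\{j\in m^{-1}\mathbb Z^n\cap\Omega:\ \tau_{mj}(Q_0)\subset m\Omega,\ \exists R\in SO(n):\ \operatorname{dist}(\nabla_d(X_m)_i,R\nabla_dZ_{l,i})|_{i\in Q_0+mj}\le \tfrac d{100}\},\\ \Omega_{b,m}&=\{j\in m^{-1}\mathbb Z^n\cap\Omega:\ \tau_{mj}(Q_0)\subset m\Omega,\ \forall l\ \forall R\in SO(n):\ \operatorname{dist}(\nabla_d(X_m)_i,R\nabla_dZ_{l,i})|_{i\in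 Q_0+mj}> \tfrac d{100}\},\\ \Omega_{bd,m}&=\{j\in m^{-1}\mathbb Z^n\cap\Omega:\ \tau_{mj}(Q_0)\cap(\mathbb Z^n\setminus m\Omega)\neq\emptyset\}. \end{aligned}$$ For a set $A\subset m^{-1}\mathbb Z^n$ let $\chi_A:\Omega\to\{0,1\}$ be the characteristic function of $\Omega\cap\bigcup_{j\in A}(j+m^{-1}[0,1)^n)$. Then there are Caccioppoli sets $\Omega_1,\dots,\Omega_k\subset\Omega$ (measurable sets of finite perimeter $|D\chi_{\Omega_l}|(\Omega)<\infty$ in $\Omega$) with $\Omega=\bigcup_{l=1}^k\Omega_l$ such that, along a subsequence of $m\to\infty$ that is the same for all $l$, $$\chi_{\Omega_{l,m}}\to\chi_{\Omega_l}\quad\text{in }L^1(\Omega),\qquad l=1,\dots,k,$$ and such that, along the full sequence $m\to\infty$, $$\chi_{\Omega_{b,m}}\to0,\qquad \chi_{\Omega_{bd,m}}\to0\quad\text{in }L^1(\Omega).$$ -/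

import Mathlib

open MeasureTheory Filter Topology
open scoped NNReal ENNReal Matrix

namespace LatticeSpin

noncomputable section

/-- Lattice sites `ℤⁿ`. -/
abbrev Site (n : ℕ) : Type := Fin n → ℤ

/-- Deformations `X : ℤⁿ → ℝⁿ`. -/
abbrev Deformation (n : ℕ) : Type := Site n → (Fin n → ℝ)

/-- The discrete gradient `∇_d X_i`, an `n × n` matrix whose `b`-th column is
`X_{i+e_b} - X_i` (so that `∇_d (R X) = R ∇_d X`). -/
def dGrad {n : ℕ} (X : Deformation n) (i : Site n) : Matrix (Fin n) (Fin n) ℝ :=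
  Matrix.of fun a b => X (i + Pi.single b 1) a - X i a

/-- The rotation group `SO(n)`. -/
abbrev SO (n : ℕ) : Submonoid (Matrix (Fin n) (Fin n) ℝ) :=
  Matrix.specialOrthogonalGroup (Fin n) ℝ

/-- The translate `τ_j(B) = {i : i - j ∈ B} = B + j`. -/
def tau {n : ℕ} (j : Site n) (B : Finset (Site n)) : Finset (Site n) :=
  B.image fun i => i + j

section
open scoped Matrix.Norms.Frobenius

/-- `dist(F_i, G_i)|_{i ∈ B} = max_{i ∈ B} |F_i - G_i|` for matrix fields `F`, `G` on the lattice,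
with the Frobenius norm on matrices. -/
def maxDist {n : ℕ} (B : Finset (Site n)) (F G : Site n → Matrix (Fin n) (Fin n) ℝ) : ℝ≥0 :=
  B.sup fun i => nndist (F i) (G i)

end

/-- A finite range energy density, written as a function of the discrete gradients on the
interaction range `Λ`: it is therefore invariant under translations `X ↦ X + b`; it is also
required to be invariant under rotations. -/
structure EnergyDensity (n : ℕ) where
  /-- interaction range -/
  range : Finset (Site n)
  /-- energy density -/
  dens : (range → Matrix (Fin n) (Fin n) ℝ) → ℝ≥0
  rot_inv : ∀ R ∈ SO n, ∀ F : range → Matrix (Fin n) (Fin n) ℝ,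
    dens (fun i => R * F i) = dens F

/-- The local energy `h(∇_d X_{j+i})_{i ∈ Λ}` at the site `j`. -/
def EnergyDensity.loc {n : ℕ} (h : EnergyDensity n) (X : Deformation n) (j : Site n) : ℝ≥0 :=
  h.dens fun i => dGrad X (j + i)

/-- `∑ h(∇_d X_{j+i})_{i ∈ Λ}` over all `j ∈ ℤⁿ` with `τ_j(Λ) ⊆ S`. -/
def EnergyDensity.energyOn {n : ℕ} (h : EnergyDensity n) (S : Set (Site n))
    (X : Deformation n) : ℝ≥0∞ :=
  ∑' j : {j : Site n // (tau j h.range : Set (Site n)) ⊆ S}, (h.loc X j : ℝ≥0∞)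

/-- The point `m⁻¹ i ∈ m⁻¹ ℤⁿ ⊆ ℝⁿ`. -/
def scaledPt {n : ℕ} (m : ℕ) (i : Site n) : EuclideanSpace ℝ (Fin n) :=
  WithLp.toLp 2 fun a => (i a : ℝ) / m

/-- The lattice points of `m Ω`, that is, the `i ∈ ℤⁿ` with `m⁻¹ i ∈ Ω`. -/
def hatΩ {n : ℕ} (Ω : Set (EuclideanSpace ℝ (Fin n))) (m : ℕ) : Set (Site n) :=
  {i | scaledPt m i ∈ Ω}

/-- The rescaled Hamiltonian `H_m`. -/
def hamiltonian {n : ℕ} (h : EnergyDensity n) (Ω : Set (EuclideanSpace ℝ (Fin n))) (m : ℕ)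
    (X : Deformation n) : ℝ≥0∞ :=
  ((m : ℝ≥0∞) ^ n)⁻¹ * h.energyOn (hatΩ Ω m) X

/-- The rectangular cell `∏ₐ {0, …, Tₐ - 1}` in `ℤⁿ`. -/
def periodCell {n : ℕ} (T : Fin n → ℕ) : Finset (Site n) :=
  Fintype.piFinset fun a => Finset.Ico (0 : ℤ) (T a)

/-- `L₀`, the largest Euclidean diameter of the period cells `Q_l`. -/
def L₀ {n k : ℕ} (T : Fin k → Fin n → ℕ) : ℝ :=
  ⨆ l, Metric.diam (scaledPt 1 '' (periodCell (T l) : Set (Site n)))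

/-- The lattice points of the cube `[0, L]ⁿ`. -/
def cube (n : ℕ) (L : ℝ) : Finset (Site n) :=
  Fintype.piFinset fun _ => Finset.Icc (0 : ℤ) ⌊L⌋

/-- The lattice points of `Q₀ = [0, L₀]ⁿ`. -/
def Q₀ {n k : ℕ} (T : Fin k → Fin n → ℕ) : Finset (Site n) := cube n (L₀ T)

/-- The averaged gradient of `Z` over the cell with side lengths `T`. -/
def avgGrad {n : ℕ} (T : Fin n → ℕ) (Z : Deformation n) : Matrix (Fin n) (Fin n) ℝ :=
  ((periodCell T).card : ℝ)⁻¹ • ∑ i ∈ periodCell T, dGrad Z i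

/-- Condition (H1) on the ground states `Z_l`, with period cells of side lengths `T l` and
separation constant `d`. -/
structure H1 {n k : ℕ} (h : EnergyDensity n) (Z : Fin k → Deformation n)
    (T : Fin k → Fin n → ℕ) (d : ℝ) : Prop where
  period_pos : ∀ l a, 0 < T l a
  periodic : ∀ l a i, dGrad (Z l) (i + Pi.single a (T l a : ℤ)) = dGrad (Z l) i
  ground : ∀ X : Deformation n, h.energyOn Set.univ X = 0 ↔
    ∃ l, ∃ R ∈ SO n, ∃ b : Fin n → ℝ, ∀ j, X j = R *ᵥ Z l j + b
  invertible : ∀ l, IsUnit (avgGrad (T l) (Z l))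
  d_pos : 0 < d
  incompatible : ∀ l₁ l₂, l₁ ≠ l₂ → ∀ R₁ ∈ SO n, ∀ R₂ ∈ SO n,
    d ≤ maxDist (Q₀ T) (fun i => R₁ * dGrad (Z l₁) i) (fun i => R₂ * dGrad (Z l₂) i)

/-- Condition (H2): coercivity with exponent `p` on the translates of a box `Λ' = [[u, v]]`
containing `Λ` and `[0, 2 L₀]ⁿ`. -/
def H2 {n k : ℕ} (h : EnergyDensity n) (Z : Fin k → Deformation n)
    (T : Fin k → Fin n → ℕ) (Ω : Set (EuclideanSpace ℝ (Fin n))) : Prop :=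
  ∃ p : ℝ, 1 < p ∧ ∃ c : ℝ, 0 < c ∧ ∃ u v : Site n,
    h.range ⊆ Finset.Icc u v ∧ cube n (2 * L₀ T) ⊆ Finset.Icc u v ∧
    ∀ (m : ℕ), 1 ≤ m → ∀ j₀ : Site n,
      (tau j₀ (Finset.Icc u v) : Set (Site n)) ⊆ hatΩ Ω m →
      ∀ (X : Deformation n) (κ : ℝ), 0 ≤ κ →
        (∀ l, ∀ R ∈ SO n,
          κ ≤ maxDist (tau j₀ (Finset.Icc u v)) (fun i => R * dGrad (Z l) i) (dGrad X)) →
        ENNReal.ofReal (c * κ ^ p) ≤ h.energyOn (tau j₀ (Finset.Icc u v) : Set (Site n)) X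

/-- The set `Ω_{l,m}`. Here and in the next two definitions a point `j ∈ m⁻¹ ℤⁿ ∩ Ω` is
recorded through the lattice site `i = m j`. -/
def phaseSet {n k : ℕ} (Ω : Set (EuclideanSpace ℝ (Fin n))) (Z : Fin k → Deformation n)
    (T : Fin k → Fin n → ℕ) (d : ℝ) (X : Deformation n) (m : ℕ) (l : Fin k) : Set (Site n) :=
  {i | scaledPt m i ∈ Ω ∧ (tau i (Q₀ T) : Set (Site n)) ⊆ hatΩ Ω m ∧
    ∃ R ∈ SO n, maxDist (tau i (Q₀ T)) (dGrad X) (fun i' => R * dGrad (Z l) i') ≤ d / 100}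

/-- The high energy set `Ω_{b,m}`. -/
def badSet {n k : ℕ} (Ω : Set (EuclideanSpace ℝ (Fin n))) (Z : Fin k → Deformation n)
    (T : Fin k → Fin n → ℕ) (d : ℝ) (X : Deformation n) (m : ℕ) : Set (Site n) :=
  {i | scaledPt m i ∈ Ω ∧ (tau i (Q₀ T) : Set (Site n)) ⊆ hatΩ Ω m ∧
    ∀ l, ∀ R ∈ SO n,
      d / 100 < maxDist (tau i (Q₀ T)) (dGrad X) (fun i' => R * dGrad (Z l) i')}

/-- The boundary layer `Ω_{bd,m}`. -/
def boundaryLayer {n k : ℕ} (Ω : Set (EuclideanSpace ℝ (Fin n)))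
    (T : Fin k → Fin n → ℕ) (m : ℕ) : Set (Site n) :=
  {i | scaledPt m i ∈ Ω ∧ ((tau i (Q₀ T) : Set (Site n)) ∩ (hatΩ Ω m)ᶜ).Nonempty}

/-- The union of the lattice cells `m⁻¹ (i + [0,1)ⁿ)`, `i ∈ A`: the subset of `ℝⁿ` whose
characteristic function is associated with a set of lattice points. -/
def cells {n : ℕ} (m : ℕ) (A : Set (Site n)) : Set (EuclideanSpace ℝ (Fin n)) :=
  {x | (fun a => ⌊(m : ℝ) * x a⌋) ∈ A}

/-- The `L¹(Ω)` distance of the characteristic functions of `A` and `B`. -/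
def charDist {n : ℕ} (Ω A B : Set (EuclideanSpace ℝ (Fin n))) : ℝ≥0∞ :=
  eLpNorm (fun x => A.indicator (fun _ => (1 : ℝ)) x - B.indicator (fun _ => (1 : ℝ)) x) 1
    (volume.restrict Ω)

/-- The divergence of a vector field. -/
def divergence {n : ℕ} (f : EuclideanSpace ℝ (Fin n) → EuclideanSpace ℝ (Fin n))
    (x : EuclideanSpace ℝ (Fin n)) : ℝ :=
  ∑ a, (fderiv ℝ f x (EuclideanSpace.single a 1)) a

/-- The perimeter `|D χ_E|(Ω)` of `E` in `Ω`: the supremum of `∫_E div f` over `C¹` vector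
fields `f` with compact support in `Ω` and `|f| ≤ 1`. -/
def perimeter {n : ℕ} (E Ω : Set (EuclideanSpace ℝ (Fin n))) : ℝ≥0∞ :=
  ⨆ (f : EuclideanSpace ℝ (Fin n) → EuclideanSpace ℝ (Fin n)) (_ : ContDiff ℝ 1 f)
    (_ : HasCompactSupport f) (_ : tsupport f ⊆ Ω) (_ : ∀ x, ‖f x‖ ≤ 1),
    ENNReal.ofReal (∫ x in E, divergence f x)

/-- Caccioppoli subsets of `Ω`: measurable subsets of finite perimeter in `Ω`. -/
structure IsCaccioppoli {n : ℕ} (E Ω : Set (EuclideanSpace ℝ (Fin n))) : Prop where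
  subset : E ⊆ Ω
  measurable : MeasurableSet E
  finite_perimeter : perimeter E Ω < ∞

end

end LatticeSpin

/-!
The energy controls the number of sites at which the phase changes, and sets whose interfaces have
bounded area are compact in `L¹`.

*Interfaces.* Call a site good if its translate of the coercivity box carries little energy; by (H2)
the deformation is then close to a rotated ground state around it. Each site enters the energy of
boundedly many translates, so that `H_m ≤ C / m` leaves only `O(m ^ (n - 1))` sites of the interior
that are not good (`mul_count_energyOn_ge_le`). If all sites in a large but fixed cube are good,
then one and the same phase is seen on `Q₀` and on its unit shifts (`H1.exists_rigidity`): an ultralimit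
of counterexamples would have zero energy without being a ground state, against (H1). The energy is
translation invariant, so that translations permute the phases up to rotations, and by (H1) a
deformation is close to at most one phase at each site (`H1.eq_of_nearPhase`). Hence, up to
`O(m ^ (n - 1))` exceptions, every interior site belongs to exactly the same phase as its neighbours
(`exists_interface_bound`). This uses no overlap of neighbouring copies of `Q₀` and covers `L₀ = 0`.

*Compactness.* Along the scales `m = 2 ^ j` the cells are nested. By a Poincaré inequality on blocks
of lattice sites (`exists_offset`), the phases agree, up to a set of volume `O(2 ^ (-s))` and a
small neighbourhood of the boundary, with unions of cells of the coarser scale `2 ^ s`. There are finitely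
many of those in the bounded set `Ω`, so that the phases are totally bounded in `L¹(Ω)`
(`exists_finite_approx`, `exists_subseq_tendsto_symmDiff`).

*Perimeter.* The interface bound also shows that a translation by `2 ^ (-s)` in a coordinate
direction changes a phase on a compact set by a volume of at most `C 2 ^ (-s)`. This estimate survives in the
limit, and bounds the perimeter through difference quotients of the test field
(`abs_setIntegral_fderiv_le`).

The high energy set and the boundary layer lie in the union of the exceptional sites and the sites
that are not interior, whose volumes tend to zero (`tendsto_volume_diff_interiorSites`).
-/


namespace LatticeSpin

noncomputable section

variable {n k : ℕ}

/-! ### Rotations, translations and ground states -/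

lemma dGrad_mulVec_add (R : Matrix (Fin n) (Fin n) ℝ) (Z : Deformation n) (b : Fin n → ℝ)
    (i : Site n) : dGrad (fun j => R *ᵥ Z j + b) i = R * dGrad Z i := by
  ext a c
  simp [dGrad, Matrix.mul_apply, Matrix.mulVec, dotProduct, mul_sub, Finset.sum_sub_distrib]

lemma dGrad_shift (X : Deformation n) (t i : Site n) :
    dGrad (fun j => X (j + t)) i = dGrad X (i + t) := by
  ext a c
  simp [dGrad, add_right_comm]

lemma transpose_mem_SO {R : Matrix (Fin n) (Fin n) ℝ} (hR : R ∈ SO n) : Rᵀ ∈ SO n := by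
  rw [Matrix.mem_specialOrthogonalGroup_iff, Matrix.mem_orthogonalGroup_iff] at *
  refine ⟨?_, by simpa using hR.2⟩
  have := mul_eq_one_comm.1 hR.1
  simpa [Matrix.star_eq_conjTranspose] using this

lemma transpose_mul_self_of_mem_SO {R : Matrix (Fin n) (Fin n) ℝ} (hR : R ∈ SO n) : Rᵀ * R = 1 := by
  rw [Matrix.mem_specialOrthogonalGroup_iff, Matrix.mem_orthogonalGroup_iff] at hR
  have := mul_eq_one_comm.1 hR.1
  simpa [Matrix.star_eq_conjTranspose] using this

/-- Compactness of `SO(n)`, along an ultrafilter. -/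
lemma exists_tendsto_of_mem_SO {ι : Type*} (𝒰 : Ultrafilter ι)
    (R : ι → Matrix (Fin n) (Fin n) ℝ) (hR : ∀ᶠ N in 𝒰, R N ∈ SO n) :
    ∃ S ∈ SO n, Tendsto R 𝒰 (𝓝 S) := by
  have hcpt : IsCompact {M : Matrix (Fin n) (Fin n) ℝ | M ∈ SO n} := by
    have hb : IsCompact {M : Matrix (Fin n) (Fin n) ℝ | ∀ a b, M a b ∈ Set.Icc (-1 : ℝ) 1} := by
      have := isCompact_univ_pi (X := fun _ : Fin n => Fin n → ℝ) (fun _ : Fin n =>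
        isCompact_univ_pi (fun _ : Fin n => (isCompact_Icc : IsCompact (Set.Icc (-1 : ℝ) 1))))
      refine this.of_isClosed_subset ?_ fun M hM a _ b _ => hM a b
      simp only [Set.ofPred_forall]
      exact isClosed_iInter fun a => isClosed_iInter fun b =>
        isClosed_Icc.preimage (f := fun M : Matrix (Fin n) (Fin n) ℝ => M a b) (by fun_prop)
    refine hb.of_isClosed_subset ?_ ?_
    · have : {M : Matrix (Fin n) (Fin n) ℝ | M ∈ SO n} = {M | M * Mᵀ = 1} ∩ {M | M.det = 1} := by
        ext M
        simp [Matrix.mem_specialOrthogonalGroup_iff, Matrix.mem_orthogonalGroup_iff]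
      rw [this]
      exact (isClosed_eq (by fun_prop) continuous_const).inter
        (isClosed_eq (by fun_prop) continuous_const)
    · intro M hM a b
      rw [Set.mem_ofPred_eq, Matrix.mem_specialOrthogonalGroup_iff] at hM
      have := entry_norm_bound_of_unitary hM.1 a b
      rwa [Real.norm_eq_abs, abs_le] at this
  obtain ⟨S, hS, hle⟩ := hcpt.ultrafilter_le_nhds (𝒰.map R) (le_principal_iff.2 hR)
  exact ⟨S, hS, hle⟩

lemma loc_eq_of_dGrad_eq (h : EnergyDensity n) {X Y : Deformation n} {R : Matrix (Fin n) (Fin n) ℝ}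
    (hR : R ∈ SO n) {j : Site n} (hXY : ∀ i ∈ h.range, dGrad X (j + i) = R * dGrad Y (j + i)) :
    h.loc X j = h.loc Y j := by
  unfold EnergyDensity.loc
  rw [← h.rot_inv R hR (fun i => dGrad Y (j + i))]
  congr 1
  funext i
  exact hXY i i.2

lemma energyOn_eq_tsum_indicator (h : EnergyDensity n) (S : Set (Site n)) (X : Deformation n) :
    h.energyOn S X = ∑' j, {j : Site n | (tau j h.range : Set (Site n)) ⊆ S}.indicator
      (fun j => (h.loc X j : ℝ≥0∞)) j :=
  tsum_subtype {j : Site n | (tau j h.range : Set (Site n)) ⊆ S} (fun j => (h.loc X j : ℝ≥0∞))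

lemma energyOn_univ_eq_zero_iff (h : EnergyDensity n) (X : Deformation n) :
    h.energyOn Set.univ X = 0 ↔ ∀ j, h.loc X j = 0 := by
  simp [EnergyDensity.energyOn]

variable {h : EnergyDensity n} {Z : Fin k → Deformation n} {T : Fin k → Fin n → ℕ} {d : ℝ}

lemma H1.loc_eq_zero (hH1 : H1 h Z T d) (l : Fin k) (j : Site n) : h.loc (Z l) j = 0 :=
  (energyOn_univ_eq_zero_iff h _).1 ((hH1.ground (Z l)).2 ⟨l, 1, one_mem _, 0, by simp⟩) j

lemma H1.exists_dGrad_eq (hH1 : H1 h Z T d) {X : Deformation n} (hX : ∀ j, h.loc X j = 0) :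
    ∃ l, ∃ R ∈ SO n, ∀ j, dGrad X j = R * dGrad (Z l) j := by
  obtain ⟨l, R, hR, b, hXb⟩ := (hH1.ground X).1 ((energyOn_univ_eq_zero_iff h _).2 hX)
  obtain rfl : X = fun j => R *ᵥ Z l j + b := funext hXb
  exact ⟨l, R, hR, fun j => dGrad_mulVec_add _ _ _ _⟩

/-- Lattice translations permute the ground states up to rotations, because the total energy is
translation invariant. -/
lemma H1.exists_dGrad_shift (hH1 : H1 h Z T d) (t : Site n) (l : Fin k) :
    ∃ l', ∃ R ∈ SO n, ∀ j, dGrad (Z l) (j + t) = R * dGrad (Z l') j := by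
  simp only [← dGrad_shift]
  refine hH1.exists_dGrad_eq fun j => ?_
  rw [← hH1.loc_eq_zero l (j + t)]
  simp [EnergyDensity.loc, dGrad_shift, add_right_comm]

/-- The zero deformation is not a ground state, since the averaged gradients of the ground states
are invertible. -/
lemma H1.exists_loc_zero_ne (hH1 : H1 h Z T d) (hn : 1 ≤ n) : ∃ j, h.loc 0 j ≠ 0 := by
  by_contra! H
  obtain ⟨l, R, hR, hj⟩ := hH1.exists_dGrad_eq H
  have hz : ∀ j, dGrad (Z l) j = 0 := fun j => by
    have h0 : dGrad (0 : Deformation n) j = 0 := by ext; simp [dGrad]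
    rw [← one_mul (dGrad (Z l) j), ← transpose_mul_self_of_mem_SO hR, mul_assoc, ← hj, h0, mul_zero]
  have hu := hH1.invertible l
  have : Nonempty (Fin n) := ⟨⟨0, hn⟩⟩
  simp [avgGrad, hz] at hu

/-! ### Closeness to a phase -/

section
open scoped Matrix.Norms.Frobenius

/-- On `B`, the gradients of `X` are within `r` of those of a rotated copy of the `l`-th ground
state. -/
def NearPhase (Z : Fin k → Deformation n) (B : Finset (Site n)) (r : ℝ) (X : Deformation n)
    (l : Fin k) : Prop :=
  ∃ R ∈ SO n, ∀ i ∈ B, ‖dGrad X i - R * dGrad (Z l) i‖ ≤ r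

lemma maxDist_le_iff {B : Finset (Site n)} {F G : Site n → Matrix (Fin n) (Fin n) ℝ} {r : ℝ}
    (hr : 0 ≤ r) : (maxDist B F G : ℝ) ≤ r ↔ ∀ i ∈ B, ‖F i - G i‖ ≤ r := by
  obtain ⟨r, rfl⟩ : ∃ r' : ℝ≥0, (r' : ℝ) = r := ⟨⟨r, hr⟩, rfl⟩
  rw [NNReal.coe_le_coe, maxDist, Finset.sup_le_iff]
  exact forall₂_congr fun i _ => by rw [← dist_eq_norm, ← NNReal.coe_le_coe, coe_nndist]

lemma nearPhase_iff {B : Finset (Site n)} {r : ℝ} (hr : 0 ≤ r) {X : Deformation n} {l : Fin k} :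
    NearPhase Z B r X l ↔
      ∃ R ∈ SO n, maxDist B (dGrad X) (fun i => R * dGrad (Z l) i) ≤ r := by
  simp only [NearPhase, maxDist_le_iff hr]

lemma NearPhase.mono {B B' : Finset (Site n)} {r : ℝ} {X : Deformation n} {l : Fin k}
    (hX : NearPhase Z B r X l) (hB : B' ⊆ B) : NearPhase Z B' r X l := by
  obtain ⟨R, hR, hj⟩ := hX
  exact ⟨R, hR, fun i hi => hj i (hB hi)⟩

lemma mem_tau {j i : Site n} {B : Finset (Site n)} : i ∈ tau j B ↔ i - j ∈ B := by
  simp [tau, sub_eq_add_neg]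

/-- A shift of the deformation preserves closeness to some phase, though it may permute the
phases. -/
lemma H1.exists_nearPhase_shift_iff (hH1 : H1 h Z T d) (t : Site n) (B : Finset (Site n)) (r : ℝ)
    (X : Deformation n) :
    (∃ l, NearPhase Z (tau t B) r X l) ↔ ∃ l, NearPhase Z B r (fun j => X (j + t)) l := by
  constructor
  · rintro ⟨l, R, hR, hj⟩
    obtain ⟨l', S, hS, hS'⟩ := hH1.exists_dGrad_shift t l
    refine ⟨l', R * S, mul_mem hR hS, fun i hi => ?_⟩
    rw [dGrad_shift, mul_assoc, ← hS']
    exact hj _ (by simpa [mem_tau] using hi)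
  · rintro ⟨l, R, hR, hj⟩
    obtain ⟨l', S, hS, hS'⟩ := hH1.exists_dGrad_shift (-t) l
    refine ⟨l', R * S, mul_mem hR hS, fun i hi => ?_⟩
    have := hj (i - t) (by simpa [mem_tau] using hi)
    rw [dGrad_shift] at this
    rw [mul_assoc, ← hS']
    simpa [sub_eq_add_neg] using this

/-- A deformation is close to at most one phase near any given site. The separation of the phases
is assumed on `Q₀` only, and is transported to the translates of `Q₀` by shifting the phases. -/
lemma H1.eq_of_nearPhase (hH1 : H1 h Z T d) {t : Site n} {X : Deformation n} {l₁ l₂ : Fin k}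
    (h₁ : NearPhase Z (tau t (Q₀ T)) (d / 100) X l₁)
    (h₂ : NearPhase Z (tau t (Q₀ T)) (d / 100) X l₂) : l₁ = l₂ := by
  by_contra hne
  have hd := hH1.d_pos
  obtain ⟨R₁, hR₁, h₁⟩ := h₁
  obtain ⟨R₂, hR₂, h₂⟩ := h₂
  obtain ⟨m₁, S₁, hS₁, e₁⟩ := hH1.exists_dGrad_shift t l₁
  obtain ⟨m₂, S₂, hS₂, e₂⟩ := hH1.exists_dGrad_shift t l₂
  by_cases hm : m₁ = m₂
  · subst hm
    have := hH1.incompatible l₁ l₂ hne _ (transpose_mem_SO hS₁) _ (transpose_mem_SO hS₂)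
    have h0 : (maxDist (Q₀ T) (fun i => S₁ᵀ * dGrad (Z l₁) i) (fun i => S₂ᵀ * dGrad (Z l₂) i) : ℝ)
        ≤ 0 := by
      rw [maxDist_le_iff le_rfl]
      intro i _
      have a₁ := e₁ (i - t)
      have a₂ := e₂ (i - t)
      rw [sub_add_cancel] at a₁ a₂
      simp [a₁, a₂, ← mul_assoc, transpose_mul_self_of_mem_SO hS₁,
        transpose_mul_self_of_mem_SO hS₂]
    linarith
  · have := hH1.incompatible m₁ m₂ hm _ (mul_mem hR₁ hS₁) _ (mul_mem hR₂ hS₂)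
    have h0 : (maxDist (Q₀ T) (fun i => R₁ * S₁ * dGrad (Z m₁) i)
        (fun i => R₂ * S₂ * dGrad (Z m₂) i) : ℝ) ≤ d / 50 := by
      rw [maxDist_le_iff (by positivity)]
      intro i hi
      have b₁ := h₁ (i + t) (by simpa [mem_tau] using hi)
      have b₂ := h₂ (i + t) (by simpa [mem_tau] using hi)
      rw [mul_assoc, mul_assoc, ← e₁, ← e₂, ← dist_eq_norm]
      rw [← dist_eq_norm] at b₁ b₂
      rw [dist_comm] at b₁
      linarith [dist_triangle (R₁ * dGrad (Z l₁) (i + t)) (dGrad X (i + t))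
        (R₂ * dGrad (Z l₂) (i + t))]
    linarith

end

/-! ### Rigidity of low energy states -/

section
open scoped Matrix.Norms.Frobenius

lemma tendsto_of_frobenius_sub_le {ι : Type*} {l : Filter ι} {F G : ι → Matrix (Fin n) (Fin n) ℝ}
    {S : Matrix (Fin n) (Fin n) ℝ} {ε : ι → ℝ} (hFG : ∀ᶠ N in l, ‖F N - G N‖ ≤ ε N)
    (hε : Tendsto ε l (𝓝 0)) (hG : Tendsto G l (𝓝 S)) : Tendsto F l (𝓝 S) := by
  have h0 : Tendsto (fun N => F N - G N) l (𝓝 0) := squeeze_zero_norm' hFG hε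
  simpa using h0.add hG

/-- A set of lattice sites containing the origin and closed under unit steps is everything. -/
lemma site_induction {P : Site n → Prop} (h0 : P 0)
    (hadd : ∀ i a, P i → P (i + Pi.single a 1)) (hsub : ∀ i a, P i → P (i - Pi.single a 1))
    (i : Site n) : P i := by
  have key : ∀ (a : Fin n) (z : ℤ) (i : Site n), P i → P (i + Pi.single a z) := by
    intro a z
    induction z with
    | zero => simp
    | succ z ih =>
      intro i hi
      have := hadd _ a (ih i hi)
      rwa [add_assoc, ← Pi.single_add] at this
    | pred z ih =>
      intro i hi
      have := hsub _ a (ih i hi)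
      rwa [add_sub_assoc, ← Pi.single_sub] at this
  have : ∀ s : Finset (Fin n), P (∑ a ∈ s, Pi.single a (i a)) := by
    intro s
    induction s using Finset.induction_on with
    | empty => simpa
    | insert a s ha ih => rw [Finset.sum_insert ha, add_comm]; exact key _ _ _ ih
  simpa [Finset.univ_sum_single] using this Finset.univ

/-- The lattice cube `[-N, N]ⁿ`. -/
def box (n N : ℕ) : Finset (Site n) := Finset.Icc (fun _ => -(N : ℤ)) (fun _ => (N : ℤ))

lemma eventually_mem_box (i : Site n) : ∀ᶠ N in atTop, i ∈ box n N := by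
  have : ∀ a, ∀ᶠ N : ℕ in atTop, -(N : ℤ) ≤ i a ∧ i a ≤ N := fun a => by
    filter_upwards [eventually_ge_atTop (i a).natAbs] with N hN
    omega
  filter_upwards [eventually_all.2 this] with N hN
  exact Finset.mem_Icc.2 ⟨fun a => (hN a).1, fun a => (hN a).2⟩

/-- Rigidity of low energy states: a deformation that is close to some phase, which may vary,
around every site of a large cube is close to a single phase around the origin. Otherwise an
ultralimit of counterexamples has zero energy without being a ground state. -/
lemma H1.exists_rigidity (hH1 : H1 h Z T d) {Λ : Finset (Site n)} (hΛ : h.range ⊆ Λ)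
    (hΛ0 : (0 : Site n) ∈ Λ) (D : Finset (Site n)) {r : ℝ} (hr : 0 < r) :
    ∃ N : ℕ, ∃ ε : ℝ, 0 < ε ∧ ∀ X : Deformation n,
      (∀ i ∈ box n N, ∃ l, NearPhase Z (tau i Λ) ε X l) → ∃ l, NearPhase Z D r X l := by
  by_contra! H
  have H' := fun N : ℕ => H N (1 / ((N : ℝ) + 1)) (by positivity)
  choose X hX hXD using H'
  let 𝒰 : Ultrafilter ℕ := hyperfilter ℕ
  have h𝒰 : (𝒰 : Filter ℕ) ≤ atTop := by
    rw [← Nat.cofinite_eq_atTop]; exact hyperfilter_le_cofinite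
  have : Nonempty (Fin k) :=
    ⟨(hX 0 0 (Finset.mem_Icc.2 ⟨fun a => by simp, fun a => by simp⟩)).choose⟩
  -- Along the ultrafilter, the gradients near each site converge to those of a rotated ground
  -- state, since there are finitely many phases and `SO(n)` is compact.
  have hlim : ∀ i, ∃ l, ∃ S ∈ SO n, ∀ i' ∈ tau i Λ,
      Tendsto (fun N => dGrad (X N) i') 𝒰 (𝓝 (S * dGrad (Z l) i')) := by
    intro i
    have hev : ∀ᶠ N in (𝒰 : Filter ℕ), i ∈ box n N := h𝒰 (eventually_mem_box i)
    have hX' := fun N => hX N i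
    unfold NearPhase at hX'
    choose! l R hR hl using hX'
    obtain ⟨l₀, -, hl₀⟩ := (isCompact_univ (X := Fin k)).ultrafilter_le_nhds (𝒰.map l) (by simp)
    obtain ⟨S, hS, hRS⟩ := exists_tendsto_of_mem_SO 𝒰 R (hev.mono fun N hN => hR N hN)
    rw [nhds_discrete, Ultrafilter.coe_map, le_pure_iff, mem_map] at hl₀
    refine ⟨l₀, S, hS, fun i' hi' => ?_⟩
    refine tendsto_of_frobenius_sub_le (G := fun N => R N * dGrad (Z l₀) i')
      (ε := fun N => 1 / ((N : ℝ) + 1)) ?_ (tendsto_one_div_add_atTop_nhds_zero_nat.mono_left h𝒰)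
      (hRS.mul_const _)
    filter_upwards [hev, hl₀] with N hN hlN
    have := hl N hN i' hi'
    rwa [show l N = l₀ from hlN] at this
  have hgrad : ∀ i, ∃ G, Tendsto (fun N => dGrad (X N) i) 𝒰 (𝓝 G) := fun i => by
    obtain ⟨l, S, -, hS⟩ := hlim i
    exact ⟨_, hS i (by simpa [mem_tau])⟩
  have hdiff : ∀ i a, ∃ y, Tendsto (fun N => X N (i + Pi.single a 1) - X N i) 𝒰 (𝓝 y) := by
    intro i a
    obtain ⟨G, hG⟩ := hgrad i
    refine ⟨fun b => G b a, tendsto_pi_nhds.2 fun b => ?_⟩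
    exact ((continuous_apply_apply b a).tendsto G).comp hG
  -- Normalized at the origin, the deformations themselves converge.
  have hconv : ∀ i, ∃ y, Tendsto (fun N => X N i - X N 0) 𝒰 (𝓝 y) := by
    refine site_induction ⟨0, by simp⟩ ?_ ?_
    · rintro i a ⟨y, hy⟩
      obtain ⟨z, hz⟩ := hdiff i a
      exact ⟨z + y, (hz.add hy).congr fun N => by abel⟩
    · rintro i a ⟨y, hy⟩
      obtain ⟨z, hz⟩ := hdiff (i - Pi.single a 1) a
      exact ⟨y - z, (hy.sub hz).congr fun N => by rw [sub_add_cancel]; abel⟩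
  choose Y hY using hconv
  have hYgrad : ∀ i, Tendsto (fun N => dGrad (X N) i) 𝒰 (𝓝 (dGrad Y i)) := by
    intro i
    refine tendsto_pi_nhds.2 fun a => tendsto_pi_nhds.2 fun b => ?_
    have := (tendsto_pi_nhds.1 (hY (i + Pi.single b 1)) a).sub (tendsto_pi_nhds.1 (hY i) a)
    refine this.congr fun N => ?_
    simp [dGrad]
  obtain ⟨l, R, hR, hYl⟩ := hH1.exists_dGrad_eq (X := Y) fun i => by
    obtain ⟨l, S, hS, hlS⟩ := hlim i
    rw [loc_eq_of_dGrad_eq h hS (Y := Z l), hH1.loc_eq_zero]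
    intro i' hi'
    exact tendsto_nhds_unique (hYgrad _) (hlS _ (by simpa [mem_tau] using hΛ hi'))
  have hD : ∀ᶠ N in (𝒰 : Filter ℕ), ∀ i ∈ D, ‖dGrad (X N) i - R * dGrad (Z l) i‖ ≤ r := by
    rw [Filter.eventually_all_finset]
    intro i _
    have : Tendsto (fun N => ‖dGrad (X N) i - R * dGrad (Z l) i‖) 𝒰 (𝓝 0) := by
      have := ((hYgrad i).sub_const (R * dGrad (Z l) i)).norm
      simpa [hYl] using this
    exact (this.eventually_lt_const hr).mono fun N hN => hN.le
  obtain ⟨N, hN⟩ := hD.exists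
  exact hXD N l ⟨R, hR, hN⟩

/-- The rigidity statement around an arbitrary site. -/
lemma H1.exists_rigidity_tau (hH1 : H1 h Z T d) {Λ : Finset (Site n)} (hΛ : h.range ⊆ Λ)
    (hΛ0 : (0 : Site n) ∈ Λ) (D : Finset (Site n)) {r : ℝ} (hr : 0 < r) :
    ∃ N : ℕ, ∃ ε : ℝ, 0 < ε ∧ ∀ (X : Deformation n) (t : Site n),
      (∀ i ∈ box n N, ∃ l, NearPhase Z (tau (i + t) Λ) ε X l) →
        ∃ l, NearPhase Z (tau t D) r X l := by
  obtain ⟨N, ε, hε, hN⟩ := hH1.exists_rigidity hΛ hΛ0 D hr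
  refine ⟨N, ε, hε, fun X t hX => ?_⟩
  rw [hH1.exists_nearPhase_shift_iff]
  refine hN _ fun i hi => ?_
  rw [← hH1.exists_nearPhase_shift_iff]
  convert hX i hi using 3
  ext j
  simp [mem_tau, sub_sub, add_comm]

lemma maxDist_comm (B : Finset (Site n)) (F G : Site n → Matrix (Fin n) (Fin n) ℝ) :
    maxDist B F G = maxDist B G F := by
  simp only [maxDist, nndist_comm]

end

/-! ### Counting interface sites -/

/-- Each site contributes to the energies of at most `|Λ|` translates of `Λ`, so that the number of
translates carrying energy at least `c` is controlled by the total energy. -/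
lemma mul_count_energyOn_ge_le (h : EnergyDensity n) (hne : h.range.Nonempty)
    (Λ : Finset (Site n)) (S : Set (Site n)) (X : Deformation n) (c : ℝ≥0∞) :
    c * Measure.count {i : Site n | (tau i Λ : Set (Site n)) ⊆ S ∧
      c ≤ h.energyOn (tau i Λ : Set (Site n)) X} ≤ Λ.card * h.energyOn S X := by
  classical
  let f : Site n → ℝ≥0∞ := fun i =>
    if (tau i Λ : Set (Site n)) ⊆ S then h.energyOn (tau i Λ : Set (Site n)) X else 0
  have h1 : c * Measure.count {i : Site n | (tau i Λ : Set (Site n)) ⊆ S ∧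
      c ≤ h.energyOn (tau i Λ : Set (Site n)) X} ≤ c * Measure.count {i | c ≤ f i} := by
    gcongr
    rintro ⟨h1, h2⟩
    simpa [f, h1] using h2
  refine h1.trans ((mul_meas_ge_le_lintegral (μ := Measure.count) (f := f)
    (by fun_prop) c).trans ?_)
  rw [lintegral_count]
  obtain ⟨r, hr⟩ := hne
  have h2 : ∀ i, f i ≤ ∑' j, ({j : Site n | (tau j h.range : Set (Site n)) ⊆ S}.indicator
      (fun j => (h.loc X j : ℝ≥0∞)) j) * (if r + j - i ∈ Λ then 1 else 0) := by
    intro i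
    by_cases hi : (tau i Λ : Set (Site n)) ⊆ S
    · simp only [f, hi, if_true]
      rw [energyOn_eq_tsum_indicator]
      refine ENNReal.tsum_le_tsum fun j => ?_
      by_cases hj : (tau j h.range : Set (Site n)) ⊆ tau i Λ
      · have hm : r + j - i ∈ Λ := by
          have := hj (show r + j ∈ (tau j h.range : Set (Site n)) by
            simpa [mem_tau] using hr)
          simpa [mem_tau] using this
        have h3 : (tau j h.range : Set (Site n)) ⊆ S := hj.trans hi
        rw [Set.indicator_of_mem (by exact hj), Set.indicator_of_mem (by exact h3)]
        simp [hm]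
      · rw [Set.indicator_of_notMem (by exact hj)]
        exact zero_le
    · simp [f, hi]
  refine (ENNReal.tsum_le_tsum h2).trans ?_
  rw [ENNReal.tsum_comm, energyOn_eq_tsum_indicator, ← ENNReal.tsum_mul_left]
  refine ENNReal.tsum_le_tsum fun j => ?_
  rw [ENNReal.tsum_mul_left, mul_comm]
  gcongr
  rw [← (Equiv.subLeft (r + j)).tsum_eq]
  simp only [Equiv.subLeft_apply, sub_sub_cancel]
  rw [tsum_eq_sum (s := Λ) (by intro b hb; simp [hb])]
  simp

lemma count_preimage_add (w : Site n) (A : Set (Site n)) :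
    Measure.count {i | i + w ∈ A} = Measure.count A := by
  rw [← Measure.count_injective_image (f := fun i : Site n => i + w) (add_left_injective w)]
  congr 1
  ext i
  exact ⟨fun ⟨j, hj, e⟩ => e ▸ hj, fun hi => ⟨i - w, by simpa using hi, by simp⟩⟩

/-- With an empty interaction range the local energy would be a constant, which is positive because
`0` is not a ground state. Every deformation would then have infinite energy. -/
lemma H1.range_nonempty (hH1 : H1 h Z T d) (hn : 1 ≤ n) {S : Set (Site n)} {X : Deformation n}
    (hX : h.energyOn S X ≠ ⊤) : h.range.Nonempty := by
  by_contra hne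
  rw [Finset.not_nonempty_iff_eq_empty] at hne
  have : IsEmpty h.range := by rw [hne]; infer_instance
  have : Nonempty (Fin n) := ⟨⟨0, hn⟩⟩
  obtain ⟨j, hj⟩ := hH1.exists_loc_zero_ne hn
  refine hX ?_
  have hc : ∀ i, h.loc X i = h.loc 0 j := fun i => congrArg h.dens (Subsingleton.elim _ _)
  rw [energyOn_eq_tsum_indicator]
  have : ∀ i, {j : Site n | (tau j h.range : Set (Site n)) ⊆ S}.indicator
      (fun j => (h.loc X j : ℝ≥0∞)) i = h.loc 0 j := fun i => by
    rw [Set.indicator_of_mem (by simp [hne, tau]), hc]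
  simp_rw [this]
  exact ENNReal.tsum_const_eq_top_of_ne_zero (by simpa using hj)

lemma L₀_nonneg (T : Fin k → Fin n → ℕ) : 0 ≤ L₀ T := Real.iSup_nonneg fun _ => Metric.diam_nonneg

lemma zero_mem_Q₀ (T : Fin k → Fin n → ℕ) : (0 : Site n) ∈ Q₀ T := by
  simp [Q₀, cube, Int.floor_nonneg, L₀_nonneg]

lemma Q₀_subset_cube (T : Fin k → Fin n → ℕ) : Q₀ T ⊆ cube n (2 * L₀ T) := by
  refine Fintype.piFinset_subset _ _ fun _ => Finset.Icc_subset_Icc_right (Int.floor_mono ?_)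
  linarith [L₀_nonneg T]

lemma mem_phaseSet_iff (hd : 0 < d) {Ω : Set (EuclideanSpace ℝ (Fin n))} {X : Deformation n}
    {m : ℕ} {l : Fin k} {i : Site n} : i ∈ phaseSet Ω Z T d X m l ↔
      (tau i (Q₀ T) : Set (Site n)) ⊆ hatΩ Ω m ∧ NearPhase Z (tau i (Q₀ T)) (d / 100) X l := by
  rw [nearPhase_iff (by positivity)]
  exact ⟨fun hi => hi.2, fun hi => ⟨hi.1 (by simpa [mem_tau] using zero_mem_Q₀ T), hi⟩⟩

/-- The combinatorial heart of the matter: up to `O(m ^ (n - 1))` exceptional sites, every site of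
the interior of `m Ω` belongs to a phase, and to the same phase as its neighbours. -/
theorem exists_interface_bound (hn : 1 ≤ n) {Ω : Set (EuclideanSpace ℝ (Fin n))}
    (hH1 : H1 h Z T d) (hH2 : H2 h Z T Ω) {X : ℕ → Deformation n} {C : ℝ}
    (hX : ∀ m : ℕ, 1 ≤ m → hamiltonian h Ω m (X m) ≤ ENNReal.ofReal (C / m)) :
    ∃ C₁ : ℝ≥0∞, C₁ ≠ ⊤ ∧ ∃ Θ : Finset (Site n), Q₀ T ⊆ Θ ∧ ∀ m : ℕ, 1 ≤ m →
      ∃ W : Set (Site n), Measure.count W ≤ C₁ * ((m : ℝ≥0∞) ^ n / m) ∧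
        ∀ i ∉ W, (∀ θ ∈ Θ, i + θ ∈ hatΩ Ω m) →
          (∃ l, i ∈ phaseSet Ω Z T d (X m) m l) ∧ i ∉ badSet Ω Z T d (X m) m ∧
          ∀ l a, i ∈ phaseSet Ω Z T d (X m) m l ↔
            i + Pi.single a 1 ∈ phaseSet Ω Z T d (X m) m l := by
  classical
  obtain ⟨p, hp, c, hc, u, v, hrange, hcube, hcoer⟩ := hH2
  set Λ := Finset.Icc u v
  have hd := hH1.d_pos
  have hpos : ∀ m : ℕ, 1 ≤ m → (m : ℝ≥0∞) ≠ 0 := fun m hm => by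
    simpa using (by omega : m ≠ 0)
  have henergy : ∀ m : ℕ, 1 ≤ m →
      h.energyOn (hatΩ Ω m) (X m) ≤ ENNReal.ofReal C * ((m : ℝ≥0∞) ^ n / m) := by
    intro m hm
    have h1 := hX m hm
    rw [hamiltonian, ENNReal.inv_mul_le_iff (pow_ne_zero _ (hpos m hm))
      (ENNReal.pow_ne_top (ENNReal.natCast_ne_top m)),
      ENNReal.ofReal_div_of_pos (by exact_mod_cast hm), ENNReal.ofReal_natCast] at h1
    refine h1.trans_eq ?_
    simp only [div_eq_mul_inv]
    ring
  have hne : h.range.Nonempty := by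
    refine hH1.range_nonempty hn (S := hatΩ Ω 1) (X := X 1)
      (ne_top_of_le_ne_top ?_ (henergy 1 le_rfl))
    simp
  let D : Finset (Site n) := Q₀ T ∪ Finset.univ.biUnion fun a => tau (Pi.single a 1) (Q₀ T)
  obtain ⟨N, ε, hε, hrigid⟩ := hH1.exists_rigidity_tau hrange
    (hcube (Q₀_subset_cube T (zero_mem_Q₀ T))) D (r := d / 100) (by positivity)
  set c' := ENNReal.ofReal (c * ε ^ p)
  have hc' : c' ≠ 0 := by simp only [c', ne_eq, ENNReal.ofReal_eq_zero, not_le]; positivity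
  refine ⟨(box n N).card * (Λ.card * ENNReal.ofReal C / c'), by finiteness,
    D ∪ (box n N).biUnion fun i => tau i Λ, ?_, fun m hm => ?_⟩
  · exact Finset.subset_union_left.trans Finset.subset_union_left
  let B : Set (Site n) := {i : Site n | (tau i Λ : Set (Site n)) ⊆ hatΩ Ω m ∧
      c' ≤ h.energyOn (tau i Λ : Set (Site n)) (X m)}
  refine ⟨⋃ o ∈ box n N, {i | i + o ∈ B}, ?_, fun i hiW hi => ?_⟩
  · refine (measure_biUnion_finset_le _ _).trans ?_
    simp only [count_preimage_add, Finset.sum_const, nsmul_eq_mul, mul_assoc]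
    gcongr
    have h1 := (mul_count_energyOn_ge_le h hne Λ (hatΩ Ω m) (X m) c').trans
      (mul_le_mul_right (henergy m hm) _)
    rw [mul_comm, ← ENNReal.le_div_iff_mul_le (.inl hc') (.inl ENNReal.ofReal_ne_top)] at h1
    refine h1.trans_eq ?_
    simp only [div_eq_mul_inv]
    ring
  · -- Around `i` every translate of `Λ` has low energy and is close to some phase by coercivity.
    have hgood : ∀ o ∈ box n N, ∃ l, NearPhase Z (tau (o + i) Λ) ε (X m) l := by
      intro o ho
      by_contra! hcon
      refine hiW (Set.mem_iUnion₂.2 ⟨o, ho, ?_⟩)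
      have hsub : (tau (i + o) Λ : Set (Site n)) ⊆ hatΩ Ω m := by
        intro j hj
        have := hi (j - i) (Finset.mem_union_right _ (Finset.mem_biUnion.2 ⟨o, ho, ?_⟩))
        · simpa using this
        · rw [Finset.mem_coe, mem_tau] at hj
          rwa [mem_tau, sub_sub]
      refine ⟨hsub, hcoer m hm _ hsub _ _ hε.le fun l R hR => ?_⟩
      by_contra! hlt
      rw [add_comm, maxDist_comm] at hlt
      exact hcon l ((nearPhase_iff hε.le).2 ⟨R, hR, hlt.le⟩)
    -- `D` contains `Q₀` and its unit shifts, so that one phase serves `i` and its neighbours.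
    obtain ⟨l, hl⟩ := hrigid (X m) i hgood
    have hmem : ∀ w, tau w (Q₀ T) ⊆ D → i + w ∈ phaseSet Ω Z T d (X m) m l := by
      intro w hw
      have hw' : tau (i + w) (Q₀ T) ⊆ tau i D := by
        intro j hj
        rw [mem_tau] at hj ⊢
        exact hw (by rwa [mem_tau, sub_sub])
      refine (mem_phaseSet_iff hd).2 ⟨fun j hj => ?_, hl.mono hw'⟩
      have := hi (j - i) (Finset.mem_union_left _ (mem_tau.1 (hw' hj)))
      simpa using this
    have h0 : i ∈ phaseSet Ω Z T d (X m) m l := by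
      simpa using hmem 0 (fun j hj => Finset.mem_union_left _ (by simpa [mem_tau] using hj))
    have h1 : ∀ a, i + Pi.single a 1 ∈ phaseSet Ω Z T d (X m) m l := fun a =>
      hmem _ (fun j hj => Finset.mem_union_right _
        (Finset.mem_biUnion.2 ⟨a, Finset.mem_univ _, hj⟩))
    refine ⟨⟨l, h0⟩, ?_, fun l' a => ⟨fun hl' => ?_, fun hl' => ?_⟩⟩
    · rintro ⟨-, -, hb⟩
      obtain ⟨-, -, R, hR, hle⟩ := h0
      exact absurd (hb l R hR) (not_lt.2 hle)
    · rw [hH1.eq_of_nearPhase ((mem_phaseSet_iff hd).1 hl').2 ((mem_phaseSet_iff hd).1 h0).2]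
      exact h1 a
    · rw [hH1.eq_of_nearPhase ((mem_phaseSet_iff hd).1 hl').2 ((mem_phaseSet_iff hd).1 (h1 a)).2]
      exact h0

/-! ### Volumes of unions of lattice cells -/

/-- The lattice site whose cell at scale `m` contains `x`. -/
def siteOf (m : ℕ) (x : EuclideanSpace ℝ (Fin n)) : Site n := fun a => ⌊(m : ℝ) * x a⌋

lemma mem_cells {m : ℕ} {A : Set (Site n)} {x : EuclideanSpace ℝ (Fin n)} :
    x ∈ cells m A ↔ siteOf m x ∈ A := Iff.rfl

lemma measurable_siteOf (m : ℕ) : Measurable (siteOf m : EuclideanSpace ℝ (Fin n) → Site n) := by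
  refine measurable_pi_lambda _ fun a => Int.measurable_floor.comp ?_
  fun_prop

lemma measurableSet_cells (m : ℕ) (A : Set (Site n)) : MeasurableSet (cells m A) :=
  measurable_siteOf m (MeasurableSet.of_discrete : MeasurableSet A)

lemma volume_cells {m : ℕ} (hm : 1 ≤ m) (A : Set (Site n)) :
    volume (cells m A) = Measure.count A / (m : ℝ≥0∞) ^ n := by
  have hm0 : (0 : ℝ) < m := by exact_mod_cast hm
  have key : (volume : Measure (EuclideanSpace ℝ (Fin n))).map (siteOf m) =
      ((m : ℝ≥0∞) ^ n)⁻¹ • Measure.count := by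
    refine Measure.ext_of_singleton fun i => ?_
    rw [Measure.map_apply (measurable_siteOf m) (measurableSet_singleton i)]
    have : (siteOf m ⁻¹' {i} : Set (EuclideanSpace ℝ (Fin n))) =
        WithLp.ofLp ⁻¹' (Set.univ.pi fun a => Set.Ico ((i a : ℝ) / m) ((i a + 1) / m)) := by
      ext x
      simp only [Set.mem_preimage, Set.mem_singleton_iff, funext_iff, siteOf, Int.floor_eq_iff,
        Set.mem_pi, Set.mem_univ, true_imp_iff, Set.mem_Ico, div_le_iff₀ hm0, lt_div_iff₀ hm0,
        mul_comm]
    rw [this, (PiLp.volume_preserving_ofLp (Fin n)).measure_preimage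
      (MeasurableSet.univ_pi fun _ => measurableSet_Ico).nullMeasurableSet, Real.volume_pi_Ico]
    simp only [← sub_div, add_sub_cancel_left, Finset.prod_const, Finset.card_univ,
      Fintype.card_fin, Measure.smul_apply, Measure.count_singleton, smul_eq_mul, mul_one]
    rw [ENNReal.ofReal_div_of_pos hm0, ENNReal.ofReal_natCast, ENNReal.ofReal_one, one_div,
      ENNReal.inv_pow]
  calc volume (cells m A) = (volume.map (siteOf m)) A :=
        (Measure.map_apply (measurable_siteOf m) MeasurableSet.of_discrete).symm
    _ = _ := by rw [key, Measure.smul_apply, smul_eq_mul, mul_comm, div_eq_mul_inv]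

lemma volume_cells_le {m : ℕ} (hm : 1 ≤ m) {A : Set (Site n)} {K : ℝ≥0∞}
    (hA : Measure.count A ≤ K * ((m : ℝ≥0∞) ^ n / m)) : volume (cells m A) ≤ K / m := by
  have hm0 : (m : ℝ≥0∞) ≠ 0 := by simpa using (by omega : m ≠ 0)
  have hmt : (m : ℝ≥0∞) ^ n ≠ ⊤ := by finiteness
  rw [volume_cells hm]
  refine (ENNReal.div_le_div_right hA _).trans_eq ?_
  rw [div_eq_mul_inv, div_eq_mul_inv, div_eq_mul_inv,
    show K * ((m : ℝ≥0∞) ^ n * (m : ℝ≥0∞)⁻¹) * ((m : ℝ≥0∞) ^ n)⁻¹ =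
      K * (m : ℝ≥0∞)⁻¹ * ((m : ℝ≥0∞) ^ n * ((m : ℝ≥0∞) ^ n)⁻¹) by ring,
    ENNReal.mul_inv_cancel (pow_ne_zero _ hm0) hmt, mul_one]

lemma tendsto_measure_diff_zero {α : Type*} [MeasurableSpace α] {μ : Measure α} {Ω : Set α}
    (hΩ : MeasurableSet Ω) (hfin : μ Ω ≠ ⊤) {A : ℕ → Set α} (hA : ∀ m, MeasurableSet (A m))
    (hx : ∀ x ∈ Ω, ∀ᶠ m in atTop, x ∈ A m) : Tendsto (fun m => μ (Ω \ A m)) atTop (𝓝 0) := by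
  have := tendsto_measure_of_ae_tendsto_indicator (μ := μ) atTop (A := ∅)
    (As := fun m => Ω \ A m) MeasurableSet.empty (fun m => hΩ.diff (hA m)) hΩ hfin
    (Eventually.of_forall fun m => Set.sdiff_subset) (Eventually.of_forall fun x => ?_)
  · simpa using this
  · by_cases hxΩ : x ∈ Ω
    · filter_upwards [hx x hxΩ] with m hm
      simp [hm]
    · exact Eventually.of_forall fun m => by simp [hxΩ]

lemma charDist_eq (Ω : Set (EuclideanSpace ℝ (Fin n))) {A B : Set (EuclideanSpace ℝ (Fin n))}
    (hA : MeasurableSet A) (hB : MeasurableSet B) :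
    charDist Ω A B = volume.restrict Ω (symmDiff A B) := by
  have h1 : charDist Ω A B = eLpNorm ((symmDiff A B).indicator fun _ => (1 : ℝ)) 1
      (volume.restrict Ω) := by
    rw [← eLpNorm_indicator_sub_indicator]; rfl
  rw [h1, eLpNorm_indicator_const (hA.symmDiff hB) one_ne_zero ENNReal.one_ne_top]
  simp

lemma norm_le_sum_abs (y : EuclideanSpace ℝ (Fin n)) : ‖y‖ ≤ ∑ a, |y a| := by
  rw [EuclideanSpace.norm_eq]
  refine Real.sqrt_le_iff.2 ⟨by positivity, ?_⟩
  simpa using Finset.sum_sq_le_sq_sum_of_nonneg (s := Finset.univ) (f := fun a => |y a|)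
    fun a _ => abs_nonneg _

lemma dist_scaledPt_le {m : ℕ} (hm : 1 ≤ m) (x : EuclideanSpace ℝ (Fin n)) (i : Site n) :
    dist (scaledPt m i) x ≤ (n + ∑ a, |((i a - siteOf m x a : ℤ) : ℝ)|) / m := by
  have hm0 : (0 : ℝ) < m := by exact_mod_cast hm
  rw [dist_eq_norm]
  refine (norm_le_sum_abs _).trans ?_
  have : ((n : ℝ) + ∑ a, |((i a - siteOf m x a : ℤ) : ℝ)|) / m =
      ∑ a, (1 + |((i a - siteOf m x a : ℤ) : ℝ)|) / m := by
    rw [← Finset.sum_div, Finset.sum_add_distrib]; simp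
  rw [this]
  refine Finset.sum_le_sum fun a _ => ?_
  rw [le_div_iff₀ hm0]
  nth_rw 1 [← abs_of_pos hm0]
  rw [← abs_mul]
  have e : (scaledPt m i - x) a * m = ((i a - siteOf m x a : ℤ) : ℝ) +
      (siteOf m x a - m * x a) := by
    simp only [scaledPt, PiLp.sub_apply, Int.cast_sub]
    field_simp
    ring
  rw [e, add_comm (1 : ℝ)]
  refine (abs_add_le _ _).trans (add_le_add le_rfl ?_)
  rw [abs_le]
  simp only [siteOf]
  constructor <;> linarith [Int.floor_le ((m : ℝ) * x a), Int.lt_floor_add_one ((m : ℝ) * x a)]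

/-- The sites `i` with `i + Θ ⊆ m Ω`. -/
def interiorSites (Ω : Set (EuclideanSpace ℝ (Fin n))) (Θ : Finset (Site n)) (m : ℕ) :
    Set (Site n) :=
  {i | ∀ θ ∈ Θ, i + θ ∈ hatΩ Ω m}

lemma eventually_siteOf_mem_interiorSites {Ω : Set (EuclideanSpace ℝ (Fin n))} (hΩ : IsOpen Ω)
    (Θ : Finset (Site n)) {x : EuclideanSpace ℝ (Fin n)} (hx : x ∈ Ω) :
    ∀ᶠ m in atTop, siteOf m x ∈ interiorSites Ω Θ m := by
  refine (Filter.eventually_all_finset Θ).2 fun θ _ => ?_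
  have h1 : Tendsto (fun m : ℕ => ((n : ℝ) + ∑ a, |(θ a : ℝ)|) / m) atTop (𝓝 0) :=
    tendsto_const_nhds.div_atTop tendsto_natCast_atTop_atTop
  have h2 : Tendsto (fun m => scaledPt m (siteOf m x + θ)) atTop (𝓝 x) := by
    refine tendsto_iff_dist_tendsto_zero.2 (squeeze_zero' (.of_forall fun _ => dist_nonneg) ?_ h1)
    filter_upwards [eventually_ge_atTop 1] with m hm
    simpa using dist_scaledPt_le hm x (siteOf m x + θ)
  exact h2.eventually (hΩ.mem_nhds hx)

lemma tendsto_volume_diff_interiorSites {Ω : Set (EuclideanSpace ℝ (Fin n))} (hΩ : IsOpen Ω)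
    (hb : Bornology.IsBounded Ω) (Θ : Finset (Site n)) :
    Tendsto (fun m => volume (Ω \ cells m (interiorSites Ω Θ m))) atTop (𝓝 0) :=
  tendsto_measure_diff_zero hΩ.measurableSet hb.measure_lt_top.ne
    (fun _ => measurableSet_cells _ _) fun _ hx => eventually_siteOf_mem_interiorSites hΩ Θ hx

lemma finite_hatΩ {Ω : Set (EuclideanSpace ℝ (Fin n))} (hb : Bornology.IsBounded Ω) {m : ℕ}
    (hm : 1 ≤ m) : (hatΩ Ω m).Finite := by
  have hm0 : (0 : ℝ) < m := by exact_mod_cast hm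
  obtain ⟨r, hr⟩ := hb.subset_closedBall 0
  refine (Set.finite_Icc (fun _ => -⌈m * r⌉ : Site n) (fun _ => ⌈m * r⌉)).subset fun i hi => ?_
  have h1 : ∀ a, |(i a : ℝ)| ≤ ⌈m * r⌉ := fun a => by
    have h2 := (PiLp.norm_apply_le (scaledPt m i) a).trans (mem_closedBall_zero_iff.1 (hr hi))
    rw [scaledPt, Real.norm_eq_abs, abs_div, abs_of_pos hm0, div_le_iff₀ hm0] at h2
    exact h2.trans (by rw [mul_comm]; exact Int.le_ceil _)
  have h3 : ∀ a, |i a| ≤ ⌈m * r⌉ := fun a => by exact_mod_cast h1 a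
  exact ⟨fun a => (abs_le.1 (h3 a)).1, fun a => (abs_le.1 (h3 a)).2⟩

/-! ### A Poincaré inequality on the lattice -/

/-- A set of lattice sites whose interface inside `U` is covered by `W` changes little under a
lattice translation: moving along `w` in unit steps, each step meets at most `W`. -/
lemma count_translate_ne_le {P U W : Set (Site n)}
    (hW : ∀ i ∈ U, i ∉ W → ∀ a, (i ∈ P ↔ i + Pi.single a 1 ∈ P)) (w : Site n) :
    Measure.count {i | Set.uIcc i (i + w) ⊆ U ∧ ¬ (i ∈ P ↔ i + w ∈ P)} ≤
      (∑ a, (w a).natAbs : ℕ) * Measure.count W := by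
  induction hs : ∑ a, (w a).natAbs generalizing w with
  | zero =>
    have : w = 0 := by
      funext a
      simpa using (Finset.sum_eq_zero_iff.1 hs) a (Finset.mem_univ a)
    subst this
    simp
  | succ s ih =>
    obtain ⟨a, -, ha⟩ : ∃ a ∈ Finset.univ, (w a).natAbs ≠ 0 := by
      by_contra! hcon
      rw [Finset.sum_eq_zero hcon] at hs
      omega
    -- `w'` is one unit step closer to the origin, and `v` is the end point of that step from
    -- which the other one is reached in the positive direction.
    obtain ⟨w', v, hw', hwv, hmem⟩ : ∃ w' v : Site n, ∑ b, (w' b).natAbs = s ∧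
        ((v = w' ∧ v + Pi.single a 1 = w) ∨ (v = w ∧ v + Pi.single a 1 = w')) ∧
        ∀ i, i + w' ∈ Set.uIcc i (i + w) := by
      have hsum : ∀ z : ℤ, (w a + z).natAbs + 1 = (w a).natAbs →
          ∑ b, ((w + Pi.single a z : Site n) b).natAbs = s := by
        intro z hz
        rw [← Finset.add_sum_erase _ _ (Finset.mem_univ a)] at hs ⊢
        have : ∑ b ∈ Finset.univ.erase a, ((w + Pi.single a z : Site n) b).natAbs =
            ∑ b ∈ Finset.univ.erase a, (w b).natAbs := by
          refine Finset.sum_congr rfl fun b hb => ?_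
          simp [Finset.ne_of_mem_erase hb]
        rw [this]
        simp only [Pi.add_apply, Pi.single_eq_same]
        omega
      have hin : ∀ z : ℤ, (0 ≤ w a + z ∧ z ≤ 0 ∨ w a + z ≤ 0 ∧ 0 ≤ z) → ∀ i,
          i + (w + Pi.single a z) ∈ Set.uIcc i (i + w) := by
        intro z hz i
        refine ⟨fun b => ?_, fun b => ?_⟩ <;>
        · by_cases hb : b = a
          · subst hb; simp only [Pi.inf_apply, Pi.sup_apply, Pi.add_apply, Pi.single_eq_same]; omega
          · simp [hb]
      rcases lt_or_gt_of_ne (Int.natAbs_ne_zero.1 ha) with hneg | hpos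
      · exact ⟨w + Pi.single a 1, w, hsum 1 (by omega), .inr ⟨rfl, rfl⟩, hin 1 (by omega)⟩
      · exact ⟨w + Pi.single a (-1), w + Pi.single a (-1), hsum (-1) (by omega),
          .inl ⟨rfl, by simp [add_assoc, ← Pi.single_add]⟩, hin (-1) (by omega)⟩
    have hsub : {i | Set.uIcc i (i + w) ⊆ U ∧ ¬ (i ∈ P ↔ i + w ∈ P)} ⊆
        {i | Set.uIcc i (i + w') ⊆ U ∧ ¬ (i ∈ P ↔ i + w' ∈ P)} ∪ {i | i + v ∈ W} := by
      rintro i ⟨hU, hne⟩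
      by_cases hvW : i + v ∈ W
      · exact .inr hvW
      refine .inl ⟨(Set.uIcc_subset_uIcc_left (hmem i)).trans hU, fun h => hne ?_⟩
      rcases hwv with ⟨rfl, rfl⟩ | ⟨rfl, rfl⟩
      · rw [h, ← add_assoc]
        exact hW _ (hU (hmem i)) hvW a
      · rw [h, ← add_assoc]
        exact (hW _ (hU Set.right_mem_uIcc) hvW a).symm
    refine (measure_mono hsub).trans ((measure_union_le _ _).trans ?_)
    rw [count_preimage_add, Nat.cast_add, add_mul, Nat.cast_one, one_mul]
    gcongr
    exact ih w' hw'

/-- The block of side length `N` that contains `i`. -/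
def blockOf (N : ℕ) (i : Site n) : Site n := fun a => i a / N

/-- A discrete Poincaré inequality. On blocks of side length `N`, a set of lattice sites agrees,
up to `O(N)` times the size of its interface, with its sample at the points at some common offset
`t` from the corners of the blocks. The offset is found by averaging. -/
lemma exists_offset {N : ℕ} (hN : 1 ≤ N) {P G W : Set (Site n)}
    (hW : ∀ i, blockOf N i ∈ G → i ∉ W → ∀ a, (i ∈ P ↔ i + Pi.single a 1 ∈ P)) :
    ∃ t : Site n, Measure.count {i | blockOf N i ∈ G ∧
      ¬ (i ∈ P ↔ (N : ℤ) • blockOf N i + t ∈ P)} ≤ (3 ^ n * n * N : ℕ) * Measure.count W := by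
  classical
  have hN0 : (0 : ℤ) < N := by exact_mod_cast hN
  let off : Finset (Site n) := Fintype.piFinset fun _ => Finset.Ico (0 : ℤ) N
  have hoff : ∀ t, t ∈ off ↔ ∀ a, 0 ≤ t a ∧ t a < N := by simp [off]
  let A : Site n → Set (Site n) := fun t =>
    {i | blockOf N i ∈ G ∧ ¬ (i ∈ P ↔ (N : ℤ) • blockOf N i + t ∈ P)}
  let E : Site n → Set (Site n) := fun w =>
    {i | Set.uIcc i (i + w) ⊆ {i | blockOf N i ∈ G} ∧ ¬ (i ∈ P ↔ i + w ∈ P)}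
  let R : Site n → Set (Site n) := fun o => {i | (fun a => i a % N) = o}
  have hAE : ∀ t ∈ off, A t ⊆ ⋃ o ∈ off, E (t - o) ∩ R o := by
    rintro t ht i ⟨hG, hne⟩
    have hmod : (fun a => i a % N) ∈ off :=
      (hoff _).2 fun a => ⟨Int.emod_nonneg _ hN0.ne', Int.emod_lt_of_pos _ hN0⟩
    have hshift : i + (t - fun a => i a % N) = (N : ℤ) • blockOf N i + t := by
      funext a
      simp only [Pi.add_apply, Pi.sub_apply, Pi.smul_apply, blockOf, smul_eq_mul]
      linarith [Int.emod_add_mul_ediv (i a) N]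
    refine Set.mem_iUnion₂.2 ⟨_, hmod, ⟨fun j hj => ?_, by rwa [hshift]⟩, rfl⟩
    have : blockOf N j = blockOf N i := by
      funext a
      have h1 := hj.1 a
      have h2 := hj.2 a
      rw [hshift] at h1 h2
      simp only [Pi.inf_apply, Pi.sup_apply, Pi.add_apply, Pi.smul_apply, blockOf,
        smul_eq_mul] at h1 h2
      have h3 := (hoff t).1 ht a
      have h4 := Int.emod_add_mul_ediv (i a) N
      have h5 := Int.emod_nonneg (i a) hN0.ne'
      have h6 := Int.emod_lt_of_pos (i a) hN0
      have h7 := Int.emod_add_mul_ediv (j a) N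
      have h8 : (j a - N * (i a / N)) / N = 0 := Int.ediv_eq_zero_of_lt (by omega) (by omega)
      rw [Int.sub_mul_ediv_left _ _ hN0.ne'] at h8
      simp only [blockOf]
      omega
    rwa [Set.mem_ofPred_eq, this]
  -- Pairs of sites in a common block differ by some `w ∈ [-N, N]ⁿ`.
  have hE : ∀ w ∈ box n N, Measure.count (E w) ≤ (n * N : ℕ) * Measure.count W := by
    intro w hw
    refine (count_translate_ne_le (fun i hi => hW i hi) w).trans ?_
    gcongr
    calc ∑ a, (w a).natAbs ≤ ∑ _a : Fin n, N := Finset.sum_le_sum fun a _ => by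
          have h1 : -(N : ℤ) ≤ w a := (Finset.mem_Icc.1 hw).1 a
          have h2 : w a ≤ N := (Finset.mem_Icc.1 hw).2 a
          omega
      _ = n * N := by simp
  have hRE : ∀ w, ∑ o ∈ off, Measure.count (E w ∩ R o) ≤ Measure.count (E w) := by
    intro w
    rw [← measure_biUnion_finset _ fun _ _ => MeasurableSet.of_discrete]
    · exact measure_mono (Set.iUnion₂_subset fun o _ => Set.inter_subset_left)
    · intro o _ o' _ hne
      refine Set.disjoint_left.2 fun i hi hi' => hne ?_
      exact hi.2.symm.trans hi'.2
  have hcard : off.card = N ^ n := by simp [off]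
  have hboxcard : (box n N).card = (2 * N + 1) ^ n := by
    simp only [box, Pi.card_Icc, Int.card_Icc, Finset.prod_const, Finset.card_univ,
      Fintype.card_fin]
    congr 1
    omega
  have hsum : ∑ t ∈ off, Measure.count (A t) ≤
      ∑ _t ∈ off, (3 ^ n * n * N : ℕ) * Measure.count W := by
    calc ∑ t ∈ off, Measure.count (A t)
        ≤ ∑ t ∈ off, ∑ o ∈ off, Measure.count (E (t - o) ∩ R o) :=
          Finset.sum_le_sum fun t ht =>
            (measure_mono (hAE t ht)).trans (measure_biUnion_finset_le _ _)
      _ = ∑ o ∈ off, ∑ t ∈ off, Measure.count (E (t - o) ∩ R o) := Finset.sum_comm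
      _ ≤ ∑ o ∈ off, ∑ w ∈ box n N, Measure.count (E w ∩ R o) := by
          refine Finset.sum_le_sum fun o ho => ?_
          rw [← Finset.sum_image (f := fun w => Measure.count (E w ∩ R o)) (g := fun t => t - o)
            (fun _ _ _ _ h => sub_left_injective h)]
          refine Finset.sum_le_sum_of_subset fun w hw => ?_
          obtain ⟨t, ht, rfl⟩ := Finset.mem_image.1 hw
          refine Finset.mem_Icc.2 ⟨fun a => ?_, fun a => ?_⟩ <;>
          · have h1 := (hoff t).1 ht a
            have h2 := (hoff o).1 ho a
            simp only [Pi.sub_apply]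
            omega
      _ = ∑ w ∈ box n N, ∑ o ∈ off, Measure.count (E w ∩ R o) := Finset.sum_comm
      _ ≤ ∑ w ∈ box n N, (n * N : ℕ) * Measure.count W :=
          Finset.sum_le_sum fun w hw => (hRE w).trans (hE w hw)
      _ ≤ _ := by
          rw [Finset.sum_const, Finset.sum_const, nsmul_eq_mul, nsmul_eq_mul, hcard, hboxcard,
            ← mul_assoc, ← mul_assoc, ← Nat.cast_mul, ← Nat.cast_mul]
          refine mul_le_mul' (Nat.cast_le.2 ?_) le_rfl
          calc (2 * N + 1) ^ n * (n * N) ≤ (3 * N) ^ n * (n * N) := by gcongr; omega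
            _ = N ^ n * (3 ^ n * n * N) := by rw [mul_pow]; ring
  by_contra hcon
  exact absurd hsum (not_le.2 (ENNReal.sum_lt_sum_of_nonempty
    ⟨0, (hoff 0).2 fun a => ⟨le_rfl, hN0⟩⟩ fun t _ => not_le.1 fun ht => hcon ⟨t, ht⟩))

/-! ### Compactness in `L¹` -/

/-- The interface of `P` in the interior of `m Ω` is covered by at most `C m ^ (n - 1)` sites. -/
def SmallInterface (Ω : Set (EuclideanSpace ℝ (Fin n))) (Θ : Finset (Site n)) (C : ℝ≥0∞) (m : ℕ)
    (P : Set (Site n)) : Prop :=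
  ∃ W : Set (Site n), Measure.count W ≤ C * ((m : ℝ≥0∞) ^ n / m) ∧
    ∀ i ∈ interiorSites Ω Θ m, i ∉ W → ∀ a, (i ∈ P ↔ i + Pi.single a 1 ∈ P)

lemma siteOf_scaledPt {m : ℕ} (hm : 1 ≤ m) (i : Site n) : siteOf m (scaledPt m i) = i := by
  have hm0 : (m : ℝ) ≠ 0 := by positivity
  funext a
  simp [siteOf, scaledPt, mul_div_cancel₀ _ hm0]

lemma blockOf_siteOf {N : ℕ} (hN : 1 ≤ N) (s : ℕ) (x : EuclideanSpace ℝ (Fin n)) :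
    blockOf N (siteOf (N * s) x) = siteOf s x := by
  funext a
  simp only [blockOf, siteOf, Nat.cast_mul, mul_assoc]
  exact Int.natCast_mul_floor_div_cancel (by omega) _

/-- The cells at scale `s` all of whose points have distance greater than `1 / s` to the
complement of `Ω`. -/
def deepCells (Ω : Set (EuclideanSpace ℝ (Fin n))) (s : ℕ) : Set (Site n) :=
  {z | ∀ x, siteOf s x = z → Metric.closedBall x (1 / s) ⊆ Ω}

lemma eventually_siteOf_mem_deepCells {Ω : Set (EuclideanSpace ℝ (Fin n))} (hΩ : IsOpen Ω)
    {x : EuclideanSpace ℝ (Fin n)} (hx : x ∈ Ω) :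
    ∀ᶠ s in atTop, siteOf s x ∈ deepCells Ω s := by
  obtain ⟨r, hr, hball⟩ := Metric.isOpen_iff.1 hΩ x hx
  have h1 : Tendsto (fun s : ℕ => (2 * (n : ℝ) + 1) / s) atTop (𝓝 0) :=
    tendsto_const_nhds.div_atTop tendsto_natCast_atTop_atTop
  filter_upwards [h1.eventually_lt_const hr, eventually_ge_atTop 1] with s hs hs1 y hy z hz
  refine hball (Metric.mem_ball.2 (lt_of_le_of_lt ?_ hs))
  have h2 := dist_scaledPt_le hs1 x (siteOf s x)
  have h3 := dist_scaledPt_le hs1 y (siteOf s x)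
  simp only [hy, sub_self, Int.cast_zero, abs_zero, Finset.sum_const_zero, add_zero] at h2 h3
  have h4 := dist_triangle4 z y (scaledPt s (siteOf s x)) x
  rw [dist_comm y] at h4
  have h5 := Metric.mem_closedBall.1 hz
  have : (2 * (n : ℝ) + 1) / s = n / s + n / s + 1 / s := by ring
  linarith

lemma deepCells_subset_hatΩ (Ω : Set (EuclideanSpace ℝ (Fin n))) {s : ℕ} (hs : 1 ≤ s) :
    deepCells Ω s ⊆ hatΩ Ω s := fun z hz =>
  hz _ (siteOf_scaledPt hs z) (Metric.mem_closedBall_self (by positivity))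

/-- At a fine scale, all sites in the deep cells of a coarse scale are interior sites. -/
lemma eventually_mem_interiorSites_of_blockOf (Ω : Set (EuclideanSpace ℝ (Fin n)))
    (Θ : Finset (Site n)) {s : ℕ} (hs : 1 ≤ s) :
    ∀ᶠ N : ℕ in atTop, ∀ i, blockOf N i ∈ deepCells Ω s → i ∈ interiorSites Ω Θ (N * s) := by
  have h1 : ∀ᶠ N : ℕ in atTop, ∀ θ ∈ Θ, (n : ℝ) + ∑ a, |(θ a : ℝ)| ≤ N :=
    (Filter.eventually_all_finset Θ).2 fun θ _ =>
      tendsto_natCast_atTop_atTop.eventually_ge_atTop _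
  filter_upwards [h1, eventually_ge_atTop 1] with N hN hN1 i hi θ hθ
  have hm : 1 ≤ N * s := Nat.mul_pos hN1 hs
  have hN0 : (0 : ℝ) < N := by exact_mod_cast hN1
  have hs0 : (0 : ℝ) < s := by exact_mod_cast hs
  refine hi (scaledPt (N * s) i) ?_ (Metric.mem_closedBall.2 ?_)
  · rw [← blockOf_siteOf hN1, siteOf_scaledPt hm]
  · have h2 := dist_scaledPt_le hm (scaledPt (N * s) i) (i + θ)
    simp only [siteOf_scaledPt hm, Pi.add_apply, add_sub_cancel_left] at h2
    refine h2.trans ?_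
    rw [Nat.cast_mul, div_le_div_iff₀ (by positivity) hs0, one_mul]
    gcongr
    exact hN θ hθ

/-- At each tolerance, the cell sets at scales `2 ^ j` with small interfaces are approximated by
finitely many sets. These are unions of cells of a fixed coarser scale, in which the finer cells are
nested because the scales are powers of two. -/
lemma exists_finite_approx {Ω : Set (EuclideanSpace ℝ (Fin n))} (hΩ : IsOpen Ω)
    (hb : Bornology.IsBounded Ω) (Θ : Finset (Site n)) {C : ℝ≥0∞} (hC : C ≠ ⊤) {ε : ℝ≥0∞}
    (hε : 0 < ε) : ∃ 𝓕 : Set (Set (EuclideanSpace ℝ (Fin n))), 𝓕.Finite ∧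
      (∀ F ∈ 𝓕, MeasurableSet F) ∧ ∀ᶠ j : ℕ in atTop, ∀ P, SmallInterface Ω Θ C (2 ^ j) P →
        ∃ F ∈ 𝓕, volume.restrict Ω (symmDiff (cells (2 ^ j) P) F) ≤ ε := by
  have hε2 : 0 < ε / 2 := ENNReal.half_pos hε.ne'
  have hpow : Tendsto (fun s : ℕ => 2 ^ s) atTop atTop :=
    tendsto_pow_atTop_atTop_of_one_lt one_lt_two
  have h1 : Tendsto (fun m : ℕ => volume (Ω \ cells m (deepCells Ω m))) atTop (𝓝 0) :=
    tendsto_measure_diff_zero hΩ.measurableSet hb.measure_lt_top.ne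
      (fun _ => measurableSet_cells _ _) fun _ hx => eventually_siteOf_mem_deepCells hΩ hx
  have h2 : Tendsto (fun m : ℕ => (3 ^ n * n : ℕ) * C / (m : ℝ≥0∞)) atTop (𝓝 0) := by
    simpa using ENNReal.Tendsto.const_div (a := (3 ^ n * n : ℕ) * C)
      ENNReal.tendsto_nat_nhds_top (.inr (by finiteness))
  obtain ⟨s, hs1, hs2⟩ := ((hpow.eventually (h1.eventually_lt_const hε2)).and
    (hpow.eventually (h2.eventually_lt_const hε2))).exists
  set G := deepCells Ω (2 ^ s)
  have hGfin : G.Finite := (finite_hatΩ hb Nat.one_le_two_pow).subset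
    (deepCells_subset_hatΩ Ω Nat.one_le_two_pow)
  refine ⟨cells (2 ^ s) '' 𝒫 G, hGfin.finite_subsets.image _, ?_, ?_⟩
  · rintro _ ⟨c, -, rfl⟩
    exact measurableSet_cells _ _
  have h3 := eventually_mem_interiorSites_of_blockOf Ω Θ (s := 2 ^ s) Nat.one_le_two_pow
  filter_upwards [((hpow.comp (tendsto_sub_atTop_nat s)).eventually h3), eventually_ge_atTop s]
    with j hj hsj P ⟨W, hWC, hW⟩
  simp only [Function.comp_apply, ← pow_add, Nat.sub_add_cancel hsj] at hj
  have hN : 1 ≤ 2 ^ (j - s) := Nat.one_le_two_pow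
  obtain ⟨t, ht⟩ := exists_offset hN (P := P) (G := G) (W := W) fun i hi => hW i (hj i hi)
  refine ⟨_, ⟨{z ∈ G | ((2 ^ (j - s) : ℕ) : ℤ) • z + t ∈ P}, fun z hz => hz.1, rfl⟩, ?_⟩
  have hblock : ∀ x : EuclideanSpace ℝ (Fin n),
      blockOf (2 ^ (j - s)) (siteOf (2 ^ j) x) = siteOf (2 ^ s) x := fun x => by
    rw [← blockOf_siteOf hN (2 ^ s), ← pow_add, Nat.sub_add_cancel hsj]
  set A := {i | blockOf (2 ^ (j - s)) i ∈ G ∧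
      ¬ (i ∈ P ↔ ((2 ^ (j - s) : ℕ) : ℤ) • blockOf (2 ^ (j - s)) i + t ∈ P)}
  have hsub : symmDiff (cells (2 ^ j) P) (cells (2 ^ s)
      {z ∈ G | ((2 ^ (j - s) : ℕ) : ℤ) • z + t ∈ P}) ∩ Ω ⊆
      (Ω \ cells (2 ^ s) G) ∪ cells (2 ^ j) A := by
    rintro x ⟨hx, hxΩ⟩
    by_cases hxG : siteOf (2 ^ s) x ∈ G
    · refine .inr ⟨by rwa [← hblock] at hxG, fun hiff => ?_⟩
      change siteOf (2 ^ j) x ∈ P ↔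
        ((2 ^ (j - s) : ℕ) : ℤ) • blockOf (2 ^ (j - s)) (siteOf (2 ^ j) x) + t ∈ P at hiff
      rw [hblock] at hiff
      simp only [Set.mem_symmDiff, mem_cells, Set.mem_ofPred_eq, hxG, true_and] at hx
      tauto
    · exact .inl ⟨hxΩ, hxG⟩
  rw [Measure.restrict_apply' hΩ.measurableSet]
  refine (measure_mono hsub).trans ((measure_union_le _ _).trans ?_)
  rw [← ENNReal.add_halves ε]
  refine add_le_add hs1.le (le_trans ?_ hs2.le)
  have h4 : Measure.count A ≤ ((3 ^ n * n * 2 ^ (j - s) : ℕ) * C) *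
      (((2 ^ j : ℕ) : ℝ≥0∞) ^ n / (2 ^ j : ℕ)) := by
    rw [mul_assoc]
    exact ht.trans (by gcongr)
  refine (volume_cells_le Nat.one_le_two_pow h4).trans_eq ?_
  have e : (2 ^ j : ℕ) = 2 ^ (j - s) * 2 ^ s := by rw [← pow_add, Nat.sub_add_cancel hsj]
  rw [e, Nat.cast_mul (3 ^ n * n), Nat.cast_mul (2 ^ (j - s)), mul_assoc, mul_left_comm]
  exact ENNReal.mul_div_mul_left _ _ (by simp) (by finiteness)

/-- Sequential compactness in `L¹` for finitely many sequences of sets, under a total boundedness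
condition. -/
lemma exists_subseq_tendsto_symmDiff {α ι : Type*} [Finite ι] [MeasurableSpace α] {μ : Measure α}
    [IsFiniteMeasure μ] {A : ι → ℕ → Set α} (hA : ∀ l j, MeasurableSet (A l j))
    (hfin : ∀ ε : ℝ≥0∞, 0 < ε → ∃ 𝓕 : Set (Set α), 𝓕.Finite ∧ (∀ F ∈ 𝓕, MeasurableSet F) ∧
      ∀ l, ∀ᶠ j in atTop, ∃ F ∈ 𝓕, μ (symmDiff (A l j) F) ≤ ε) :
    ∃ φ : ℕ → ℕ, StrictMono φ ∧ ∃ E : ι → Set α, (∀ l, MeasurableSet (E l)) ∧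
      ∀ l, Tendsto (fun j => μ (symmDiff (A l (φ j)) (E l))) atTop (𝓝 0) := by
  have := Fintype.ofFinite ι
  let g : {s : Set α // MeasurableSet s} → Lp ℝ 1 μ := fun s =>
    indicatorConstLp 1 s.2 (measure_ne_top μ s.1) 1
  have hg : ∀ s t, edist (g s) (g t) = μ (symmDiff s.1 t.1) := by
    intro s t
    rw [edist_indicatorConstLp_eq_enorm, ← ofReal_norm,
      norm_indicatorConstLp one_ne_zero ENNReal.one_ne_top]
    simp [measureReal_def]
  let a : ι → ℕ → Lp ℝ 1 μ := fun l j => g ⟨A l j, hA l j⟩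
  have htb : ∀ l, TotallyBounded (Set.range (a l)) := by
    intro l
    refine EMetric.totallyBounded_iff.2 fun ε hε => ?_
    obtain ⟨ε', hε', hlt⟩ := exists_between hε
    obtain ⟨𝓕, h𝓕, hmeas, hev⟩ := hfin ε' hε'
    obtain ⟨j₀, hj₀⟩ := eventually_atTop.1 (hev l)
    refine ⟨g '' {F | F.1 ∈ 𝓕} ∪ a l '' Set.Iio j₀, ((h𝓕.preimage
      Subtype.val_injective.injOn).image _).union ((Set.finite_Iio j₀).image _), ?_⟩
    rintro _ ⟨j, rfl⟩
    rcases lt_or_ge j j₀ with hj | hj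
    · exact Set.mem_iUnion₂.2 ⟨a l j, .inr ⟨j, hj, rfl⟩, Metric.mem_eball_self hε⟩
    · obtain ⟨F, hF, hle⟩ := hj₀ j hj
      refine Set.mem_iUnion₂.2 ⟨_, .inl ⟨⟨F, hmeas F hF⟩, hF, rfl⟩, ?_⟩
      rw [Metric.mem_eball, hg]
      exact hle.trans_lt hlt
  have hcpt : IsCompact (Set.univ.pi fun l => closure (Set.range (a l))) :=
    isCompact_univ_pi fun l => (htb l).closure.isCompact_of_isClosed isClosed_closure
  obtain ⟨f, -, φ, hφ, hlim⟩ := hcpt.tendsto_subseq (x := fun j l => a l j)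
    fun j l _ => subset_closure ⟨j, rfl⟩
  have hEm : ∀ l, MeasurableSet {x | 1 / 2 < f l x} := fun l =>
    measurableSet_lt measurable_const (Lp.stronglyMeasurable (f l)).measurable
  refine ⟨φ, hφ, fun l => {x | 1 / 2 < f l x}, hEm, fun l => ?_⟩
  have h1 : Tendsto (fun j => 2 * edist (a l (φ j)) (f l)) atTop (𝓝 0) := by
    have := ENNReal.Tendsto.const_mul (a := 2) (tendsto_iff_edist_tendsto_0.1
      ((tendsto_pi_nhds.1 hlim) l)) (.inr (by simp))
    simpa using this
  refine tendsto_of_tendsto_of_tendsto_of_le_of_le tendsto_const_nhds h1 (fun _ => zero_le)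
    fun j => ?_
  -- A value on the wrong side of `1 / 2` is at distance at least `1 / 2` from the indicator.
  have h2 := mul_meas_ge_le_lintegral (μ := μ)
    (f := fun x => 2 * ‖(a l (φ j) - f l : Lp ℝ 1 μ) x‖ₑ) (by fun_prop) 1
  rw [one_mul, lintegral_const_mul _ (by fun_prop), ← eLpNorm_one_eq_lintegral_enorm,
    ← Lp.enorm_def, ← edist_eq_enorm_sub] at h2
  refine le_trans (measure_mono_ae ?_) h2
  filter_upwards [Lp.coeFn_sub (a l (φ j)) (f l), indicatorConstLp_coeFn (p := 1)
    (hs := hA l (φ j)) (hμs := measure_ne_top μ _) (c := (1 : ℝ))] with x hx1 hx2 hx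
  have hx2' : (a l (φ j) : α → ℝ) x = (A l (φ j)).indicator (fun _ => 1) x := hx2
  have key : 1 ≤ 2 * ‖(a l (φ j) : α → ℝ) x - f l x‖ := by
    rw [hx2', Real.norm_eq_abs]
    rcases hx with ⟨h3, h4⟩ | ⟨h3, h4⟩
    · have h4' : f l x ≤ 1 / 2 := not_lt.1 h4
      rw [Set.indicator_of_mem h3]
      linarith [le_abs_self (1 - f l x)]
    · have h3' : 1 / 2 < f l x := h3
      rw [Set.indicator_of_notMem h4]
      linarith [neg_abs_le (0 - f l x)]
  change 1 ≤ 2 * ‖(a l (φ j) - f l : Lp ℝ 1 μ) x‖ₑ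
  rw [hx1, Pi.sub_apply, ← ofReal_norm]
  calc (1 : ℝ≥0∞) = ENNReal.ofReal 1 := by simp
    _ ≤ ENNReal.ofReal (2 * ‖(a l (φ j) : α → ℝ) x - f l x‖) := ENNReal.ofReal_le_ofReal key
    _ = _ := by rw [ENNReal.ofReal_mul zero_le_two]; simp

/-! ### Finite perimeter of the limits -/

lemma siteOf_add_single {N s : ℕ} (hs : 1 ≤ s) (x : EuclideanSpace ℝ (Fin n)) (a : Fin n) :
    siteOf (N * s) (x + EuclideanSpace.single a (1 / (s : ℝ))) =
      siteOf (N * s) x + Pi.single a (N : ℤ) := by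
  have hs0 : (s : ℝ) ≠ 0 := by positivity
  funext b
  by_cases hb : b = a
  · subst hb
    have : ((N * s : ℕ) : ℝ) * (x b + 1 / s) = (N * s : ℕ) * x b + (N : ℤ) := by
      push_cast
      field_simp
    simp [siteOf, this, -one_div, -Nat.cast_mul]
  · simp [siteOf, hb]

/-- Translating a cell set by the coarser mesh size `1 / s` in a coordinate direction changes it
inside a compact set only on a set of measure `O(1 / s)`. -/
lemma volume_translate_cells_le {Ω K : Set (EuclideanSpace ℝ (Fin n))} {δ : ℝ}
    (hK : Metric.cthickening δ K ⊆ Ω) {Θ : Finset (Site n)} {C : ℝ≥0∞} {N s : ℕ} (hN : 1 ≤ N)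
    (hs : 1 ≤ s) (hsδ : 1 / (s : ℝ) ≤ δ / 2)
    (hNδ : ∀ θ ∈ Θ, ((n : ℝ) + ∑ a, |(θ a : ℝ)|) / N ≤ δ / 2) {P : Set (Site n)}
    (hP : SmallInterface Ω Θ C (N * s) P) (a : Fin n) :
    volume {x | x ∈ K ∧ ¬ (x ∈ cells (N * s) P ↔
      x + EuclideanSpace.single a (1 / (s : ℝ)) ∈ cells (N * s) P)} ≤ C / s := by
  obtain ⟨W, hWC, hW⟩ := hP
  have hm : 1 ≤ N * s := Nat.mul_pos hN hs
  have hN0 : (0 : ℝ) < N := by exact_mod_cast hN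
  have hs1 : (1 : ℝ) ≤ s := by exact_mod_cast hs
  set w : Site n := Pi.single a (N : ℤ)
  have hsub : {x | x ∈ K ∧ ¬ (x ∈ cells (N * s) P ↔
      x + EuclideanSpace.single a (1 / (s : ℝ)) ∈ cells (N * s) P)} ⊆
      cells (N * s) {i | Set.uIcc i (i + w) ⊆ interiorSites Ω Θ (N * s) ∧
        ¬ (i ∈ P ↔ i + w ∈ P)} := by
    rintro x ⟨hxK, hne⟩
    rw [mem_cells, mem_cells, siteOf_add_single hs] at hne
    refine ⟨fun i hi θ hθ => hK ?_, hne⟩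
    refine Metric.mem_cthickening_of_dist_le _ x _ _ hxK ((dist_scaledPt_le hm x _).trans ?_)
    -- A site between those of `x` and of its translate is at distance at most `N` from that of `x`.
    have hb : ∑ b, |(((i + θ) b - siteOf (N * s) x b : ℤ) : ℝ)| ≤ N + ∑ b, |(θ b : ℝ)| := by
      have : ∀ b, |(((i + θ) b - siteOf (N * s) x b : ℤ) : ℝ)| ≤
          (Pi.single a (N : ℝ) : Fin n → ℝ) b + |(θ b : ℝ)| := by
        intro b
        have e : (((i + θ) b - siteOf (N * s) x b : ℤ) : ℝ) =
            ((i b - siteOf (N * s) x b : ℤ) : ℝ) + θ b := by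
          push_cast [Pi.add_apply]; ring
        rw [e]
        refine (abs_add_le _ _).trans (add_le_add ?_ le_rfl)
        have h1 := hi.1 b
        have h2 := hi.2 b
        change (siteOf (N * s) x) b ⊓ ((siteOf (N * s) x) b + w b) ≤ i b at h1
        change i b ≤ (siteOf (N * s) x) b ⊔ ((siteOf (N * s) x) b + w b) at h2
        have h3 : |i b - siteOf (N * s) x b| ≤ (Pi.single a (N : ℤ) : Site n) b := by
          by_cases hb : b = a
          · subst hb
            simp only [w, Pi.single_eq_same] at h1 h2 ⊢
            rw [abs_le]
            omega
          · simp only [w, Pi.single_eq_of_ne hb] at h1 h2 ⊢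
            rw [abs_le]
            omega
        have h4 : ((|i b - siteOf (N * s) x b| : ℤ) : ℝ) ≤
            ((Pi.single a (N : ℤ) : Site n) b : ℤ) := by exact_mod_cast h3
        rw [Int.cast_abs] at h4
        refine h4.trans_eq ?_
        by_cases hb : b = a
        · subst hb; simp
        · simp [hb]
      refine (Finset.sum_le_sum fun b _ => this b).trans_eq ?_
      rw [Finset.sum_add_distrib]
      simp
    calc ((n : ℝ) + ∑ b, |(((i + θ) b - siteOf (N * s) x b : ℤ) : ℝ)|) / (N * s : ℕ)
        ≤ (n + (N + ∑ b, |(θ b : ℝ)|)) / (N * s : ℕ) := by gcongr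
      _ = (n + ∑ b, |(θ b : ℝ)|) / N / s + 1 / s := by push_cast; field_simp; ring
      _ ≤ (n + ∑ b, |(θ b : ℝ)|) / N + 1 / s := by
          exact add_le_add (div_le_self (by positivity) hs1) le_rfl
      _ ≤ δ / 2 + δ / 2 := add_le_add (hNδ θ hθ) hsδ
      _ = δ := add_halves δ
  refine (measure_mono hsub).trans ?_
  have hcount : Measure.count {i | Set.uIcc i (i + w) ⊆ interiorSites Ω Θ (N * s) ∧
      ¬ (i ∈ P ↔ i + w ∈ P)} ≤ (N * C) * (((N * s : ℕ) : ℝ≥0∞) ^ n / (N * s : ℕ)) := by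
    refine (count_translate_ne_le hW w).trans ?_
    have : ∑ b, (w b).natAbs = N := by
      rw [Finset.sum_eq_single a (fun b _ hb => by simp [w, hb]) (by simp)]
      simp [w]
    rw [this, mul_assoc]
    gcongr
  refine (volume_cells_le hm hcount).trans_eq ?_
  rw [Nat.cast_mul]
  exact ENNReal.mul_div_mul_left _ _ (by simpa using (by omega : N ≠ 0)) (by finiteness)

/-- The translation estimate for cell sets passes to their limits in `L¹`. -/
lemma eventually_volume_translate_le {Ω K E : Set (EuclideanSpace ℝ (Fin n))} (hΩ : IsOpen Ω)
    (hK : IsCompact K) (hKΩ : K ⊆ Ω) {Θ : Finset (Site n)} {C : ℝ≥0∞} {φ : ℕ → ℕ}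
    (hφ : StrictMono φ) {P : ℕ → Set (Site n)}
    (hP : ∀ j, SmallInterface Ω Θ C (2 ^ φ j) (P j))
    (hlim : Tendsto (fun j => volume.restrict Ω (symmDiff (cells (2 ^ φ j) (P j)) E)) atTop (𝓝 0))
    (a : Fin n) : ∀ᶠ s : ℕ in atTop,
      volume {x | x ∈ K ∧ ¬ (x ∈ E ↔ x + EuclideanSpace.single a (1 / ((2 ^ s : ℕ) : ℝ)) ∈ E)} ≤
        C / (2 ^ s : ℕ) := by
  obtain ⟨δ, hδ, hKδ⟩ := hK.exists_cthickening_subset_open hΩ hKΩ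
  have hpow : Tendsto (fun s : ℕ => 2 ^ s) atTop atTop :=
    tendsto_pow_atTop_atTop_of_one_lt one_lt_two
  have h1 : Tendsto (fun m : ℕ => 1 / (m : ℝ)) atTop (𝓝 0) := tendsto_one_div_atTop_nhds_zero_nat
  filter_upwards [hpow.eventually (h1.eventually_lt_const (half_pos hδ))] with s hs
  have hs1 : 1 ≤ 2 ^ s := Nat.one_le_two_pow
  have h2 : ∀ᶠ N : ℕ in atTop, ∀ θ ∈ Θ, ((n : ℝ) + ∑ a, |(θ a : ℝ)|) / N ≤ δ / 2 := by
    refine (Filter.eventually_all_finset Θ).2 fun θ _ => ?_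
    have : Tendsto (fun N : ℕ => ((n : ℝ) + ∑ a, |(θ a : ℝ)|) / N) atTop (𝓝 0) :=
      tendsto_const_nhds.div_atTop tendsto_natCast_atTop_atTop
    exact (this.eventually_lt_const (half_pos hδ)).mono fun N hN => hN.le
  set v : EuclideanSpace ℝ (Fin n) := EuclideanSpace.single a (1 / ((2 ^ s : ℕ) : ℝ))
  have hv : ∀ x ∈ K, x + v ∈ Ω := by
    intro x hx
    refine hKδ (Metric.mem_cthickening_of_dist_le _ x _ _ hx ?_)
    have : ‖v‖ = 1 / ((2 ^ s : ℕ) : ℝ) := by simp [v]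
    rw [dist_self_add_left, this]
    linarith
  have h3 : Tendsto (fun j => C / (2 ^ s : ℕ) +
      2 * volume.restrict Ω (symmDiff (cells (2 ^ φ j) (P j)) E)) atTop
      (𝓝 (C / (2 ^ s : ℕ) + 2 * 0)) :=
    tendsto_const_nhds.add (ENNReal.Tendsto.const_mul hlim (.inr (by simp)))
  rw [mul_zero, add_zero] at h3
  refine ge_of_tendsto h3 ?_
  have h4 := (hpow.comp ((tendsto_sub_atTop_nat s).comp hφ.tendsto_atTop)).eventually h2
  simp only [Function.comp_apply] at h4
  filter_upwards [h4, hφ.tendsto_atTop.eventually_ge_atTop s] with j hj hsj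
  have e : 2 ^ φ j = 2 ^ (φ j - s) * 2 ^ s := by rw [← pow_add, Nat.sub_add_cancel hsj]
  have hPj := hP j
  rw [e] at hPj
  have h5 := volume_translate_cells_le hKδ Nat.one_le_two_pow hs1 hs.le hj hPj a
  rw [← e] at h5
  set A := cells (2 ^ φ j) (P j)
  rw [Measure.restrict_apply' hΩ.measurableSet, two_mul]
  have hsub : {x | x ∈ K ∧ ¬ (x ∈ E ↔ x + v ∈ E)} ⊆ {x | x ∈ K ∧ ¬ (x ∈ A ↔ x + v ∈ A)} ∪
      (symmDiff A E ∩ Ω ∪ (fun x => x + v) ⁻¹' (symmDiff A E ∩ Ω)) := by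
    rintro x ⟨hx, hne⟩
    have hx1 := hKΩ hx
    have hx2 := hv x hx
    simp only [Set.mem_union, Set.mem_ofPred_eq, Set.mem_inter_iff, Set.mem_preimage,
      Set.mem_symmDiff]
    tauto
  refine (measure_mono hsub).trans ((measure_union_le _ _).trans (add_le_add h5 ?_))
  refine (measure_union_le _ _).trans_eq ?_
  rw [measure_preimage_add_right]

/-- If translating `E` by `2⁻ˢ` in the direction `a` changes it on the support of the test function
`g` by a volume of at most `C 2⁻ˢ`, then `∫_E ∂ₐ g` is at most `C` in absolute value. The derivative
of `g` is replaced by difference quotients, which a change of variables shifts to `E`. -/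
lemma abs_setIntegral_fderiv_le {Ω E : Set (EuclideanSpace ℝ (Fin n))}
    (hb : Bornology.IsBounded Ω) (hE : MeasurableSet E) (hEΩ : E ⊆ Ω) {C : ℝ≥0∞} (hC : C ≠ ⊤)
    (a : Fin n) {g : EuclideanSpace ℝ (Fin n) → ℝ} (hg : ContDiff ℝ 1 g) (hgc : HasCompactSupport g)
    (hg1 : ∀ x, |g x| ≤ 1)
    (hK : ∀ᶠ s : ℕ in atTop, volume {x | x ∈ tsupport g ∧
      ¬ (x ∈ E ↔ x + EuclideanSpace.single a (1 / ((2 ^ s : ℕ) : ℝ)) ∈ E)} ≤ C / (2 ^ s : ℕ)) :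
    |∫ x in E, fderiv ℝ g x (EuclideanSpace.single a 1)| ≤ C.toReal := by
  classical
  obtain ⟨L, hL⟩ := hg.lipschitzWith_of_hasCompactSupport hgc one_ne_zero
  let v : ℕ → EuclideanSpace ℝ (Fin n) := fun s => EuclideanSpace.single a (1 / ((2 ^ s : ℕ) : ℝ))
  have hv : ∀ s, ‖v s‖ = ((2 ^ s : ℕ) : ℝ)⁻¹ := fun s => by simp [v]
  have hpos : ∀ s : ℕ, (0 : ℝ) < (2 ^ s : ℕ) := fun s => by positivity
  have : IsFiniteMeasure (volume.restrict E) :=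
    ⟨by simpa using (measure_mono hEΩ).trans_lt hb.measure_lt_top⟩
  have hgi : Integrable g := hg.continuous.integrable_of_hasCompactSupport hgc
  have hlim : Tendsto (fun s : ℕ => ∫ x in E, ((2 ^ s : ℕ) : ℝ) * (g x - g (x - v s))) atTop
      (𝓝 (∫ x in E, fderiv ℝ g x (EuclideanSpace.single a 1))) := by
    refine tendsto_integral_of_dominated_convergence (fun _ => (L : ℝ)) (fun s => ?_)
      (integrable_const _) (fun s => .of_forall fun x => ?_) (.of_forall fun x => ?_)
    · have := hg.continuous
      have hcont : Continuous fun x => ((2 ^ s : ℕ) : ℝ) * (g x - g (x - v s)) := by fun_prop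
      exact hcont.aestronglyMeasurable
    · rw [norm_mul, Real.norm_of_nonneg (hpos s).le]
      have := hL.norm_sub_le x (x - v s)
      rw [sub_sub_cancel, hv] at this
      calc _ ≤ ((2 ^ s : ℕ) : ℝ) * (L * ((2 ^ s : ℕ) : ℝ)⁻¹) := by gcongr
        _ = L := by field_simp
    · have h1 := (hg.differentiable one_ne_zero x).hasFDerivAt.hasLineDerivAt
        (EuclideanSpace.single a 1)
      have h2 : Tendsto (fun s : ℕ => -((2 ^ s : ℕ) : ℝ)⁻¹) atTop (𝓝[≠] 0) := by
        refine tendsto_nhdsWithin_iff.2 ⟨?_, .of_forall fun s => by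
          simp⟩
        have : Tendsto (fun s : ℕ => ((2 ^ s : ℕ) : ℝ)⁻¹) atTop (𝓝 0) :=
          tendsto_inv_atTop_zero.comp (tendsto_natCast_atTop_atTop.comp
            (tendsto_pow_atTop_atTop_of_one_lt one_lt_two))
        simpa using this.neg
      refine ((HasDerivAt.tendsto_slope_zero h1).comp h2).congr fun s => ?_
      have e : x - v s = x + (-((2 ^ s : ℕ) : ℝ)⁻¹) • EuclideanSpace.single a (1 : ℝ) := by
        rw [sub_eq_add_neg, neg_smul]
        congr 2
        ext b
        by_cases hb : b = a
        · subst hb; simp [v]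
        · simp [v, hb]
      simp only [Function.comp_apply, zero_add, zero_smul, add_zero, smul_eq_mul, ← e, inv_neg,
        inv_inv]
      ring
  refine le_of_tendsto hlim.abs ?_
  filter_upwards [hK] with s hs
  set S := {x | x ∈ tsupport g ∧ ¬ (x ∈ E ↔ x + v s ∈ E)}
  have hS : MeasurableSet S := by
    have h1 : MeasurableSet ((fun x => x + v s) ⁻¹' E) := hE.preimage (measurable_add_const _)
    exact (isClosed_tsupport g).measurableSet.inter (hE.iff h1).compl
  have hfinS : volume S ≠ ⊤ := ne_top_of_le_ne_top (by finiteness) hs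
  have hgi' : Integrable fun x => g (x - v s) := hgi.comp_sub_right _
  have hshift : ∫ x in E, g (x - v s) = ∫ x, ((fun x => x + v s) ⁻¹' E).indicator g x := by
    rw [← integral_indicator hE, ← integral_add_right_eq_self _ (v s)]
    refine integral_congr_ae (.of_forall fun x => ?_)
    by_cases hx : x + v s ∈ E
    · simp [Set.indicator, hx]
    · simp [Set.indicator, hx]
  have hE' : MeasurableSet ((fun x => x + v s) ⁻¹' E) := hE.preimage (measurable_add_const _)
  rw [integral_const_mul, integral_sub hgi.integrableOn hgi'.integrableOn, hshift,
    ← integral_indicator hE, ← integral_sub (hgi.indicator hE) (hgi.indicator hE'), abs_mul,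
    abs_of_pos (hpos s)]
  have hle : |∫ x, (E.indicator g x - ((fun x => x + v s) ⁻¹' E).indicator g x)| ≤
      ∫ x, S.indicator (fun _ => (1 : ℝ)) x := by
    rw [← Real.norm_eq_abs]
    refine norm_integral_le_of_norm_le ((integrable_indicator_iff hS).2
      (integrableOn_const hfinS)) (.of_forall fun x => ?_)
    by_cases hxg : g x = 0
    · rw [Set.indicator_apply, Set.indicator_apply, hxg]
      simp [Set.indicator_nonneg]
    have hxK : x ∈ tsupport g := subset_tsupport g hxg
    by_cases h1 : x ∈ E <;> by_cases h2 : x + v s ∈ E <;>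
      simp [Set.indicator, S, h1, h2, hxK, hg1 x]
  rw [integral_indicator_const _ hS, smul_eq_mul, mul_one] at hle
  calc _ ≤ ((2 ^ s : ℕ) : ℝ) * volume.real S := by gcongr
    _ ≤ ((2 ^ s : ℕ) : ℝ) * (C / (2 ^ s : ℕ) : ℝ≥0∞).toReal := by
        gcongr
        exact ENNReal.toReal_mono (by finiteness) hs
    _ = C.toReal := by
        rw [ENNReal.toReal_div, ENNReal.toReal_natCast]
        field_simp

/-- An `L¹` limit of cell sets with small interfaces has finite perimeter. -/
lemma perimeter_lt_top {Ω E : Set (EuclideanSpace ℝ (Fin n))} (hΩ : IsOpen Ω)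
    (hb : Bornology.IsBounded Ω) (hE : MeasurableSet E) (hEΩ : E ⊆ Ω) {Θ : Finset (Site n)}
    {C : ℝ≥0∞} (hC : C ≠ ⊤) {φ : ℕ → ℕ} (hφ : StrictMono φ) {P : ℕ → Set (Site n)}
    (hP : ∀ j, SmallInterface Ω Θ C (2 ^ φ j) (P j))
    (hlim : Tendsto (fun j => volume.restrict Ω (symmDiff (cells (2 ^ φ j) (P j)) E)) atTop
      (𝓝 0)) : perimeter E Ω < ⊤ := by
  refine lt_of_le_of_lt (b := ENNReal.ofReal (n * C.toReal)) ?_ ENNReal.ofReal_lt_top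
  unfold perimeter
  refine iSup_le fun f => iSup_le fun hf => iSup_le fun hfc => iSup_le fun hfΩ => iSup_le fun hf1 =>
    ENNReal.ofReal_le_ofReal ?_
  have hcomp : ∀ a : Fin n, ContDiff ℝ 1 fun x => f x a := fun a =>
    (EuclideanSpace.proj (𝕜 := ℝ) a).contDiff.comp hf
  have hsupp : ∀ a : Fin n, tsupport (fun x => f x a) ⊆ tsupport f := fun a =>
    closure_mono fun x hx hfx => hx (by simp [hfx])
  have hcs : ∀ a : Fin n, HasCompactSupport fun x => f x a := fun a =>
    hfc.of_isClosed_subset (isClosed_tsupport _) (hsupp a)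
  have hder : ∀ x a, (fderiv ℝ f x (EuclideanSpace.single a 1)) a =
      fderiv ℝ (fun x => f x a) x (EuclideanSpace.single a 1) := by
    intro x a
    have h1 := (EuclideanSpace.proj (𝕜 := ℝ) a).hasFDerivAt.comp x
      (hf.differentiable one_ne_zero x).hasFDerivAt
    exact (congrArg (fun A => A (EuclideanSpace.single a (1 : ℝ))) h1.fderiv).symm
  have hint : ∀ a : Fin n, Integrable fun x =>
      fderiv ℝ (fun x => f x a) x (EuclideanSpace.single a 1) := fun a => by
    have h1 : Continuous fun x => fderiv ℝ (fun x => f x a) x (EuclideanSpace.single a 1) :=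
      ((hcomp a).continuous_fderiv one_ne_zero).clm_apply continuous_const
    exact h1.integrable_of_hasCompactSupport ((hcs a).fderiv_apply ℝ _)
  simp only [divergence, hder]
  rw [integral_finsetSum _ fun a _ => (hint a).integrableOn]
  calc ∑ a, ∫ x in E, fderiv ℝ (fun x => f x a) x (EuclideanSpace.single a 1)
      ≤ ∑ _a : Fin n, C.toReal := Finset.sum_le_sum fun a _ => (le_abs_self _).trans
        (abs_setIntegral_fderiv_le hb hE hEΩ hC a (hcomp a) (hcs a)
          (fun x => (PiLp.norm_apply_le (f x) a).trans (hf1 x))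
          (eventually_volume_translate_le hΩ (hcs a) ((hsupp a).trans hfΩ) hφ hP hlim a))
    _ = n * C.toReal := by simp

end

end LatticeSpin

open LatticeSpin

theorem mainTheorem4 (n k : ℕ) (hn : 1 ≤ n)
    (Ω : Set (EuclideanSpace ℝ (Fin n))) (hΩ_open : IsOpen Ω) (hΩ_bdd : Bornology.IsBounded Ω)
    (h : LatticeSpin.EnergyDensity n)
    (Z : Fin k → LatticeSpin.Deformation n) (T : Fin k → Fin n → ℕ) (d : ℝ)
    (hH1 : LatticeSpin.H1 h Z T d) (hH2 : LatticeSpin.H2 h Z T Ω)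
    (X : ℕ → LatticeSpin.Deformation n) (C : ℝ)
    (hX : ∀ m : ℕ, 1 ≤ m → LatticeSpin.hamiltonian h Ω m (X m) ≤ ENNReal.ofReal (C / m)) :
    (∃ φ : ℕ → ℕ, StrictMono φ ∧ ∃ E : Fin k → Set (EuclideanSpace ℝ (Fin n)),
      (∀ l, LatticeSpin.IsCaccioppoli (E l) Ω) ∧
      (⋃ l, E l) = Ω ∧
      ∀ l, Tendsto (fun j => LatticeSpin.charDist Ω
        (LatticeSpin.cells (φ j) (LatticeSpin.phaseSet Ω Z T d (X (φ j)) (φ j) l)) (E l))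
        atTop (𝓝 0)) ∧
    Tendsto (fun m => LatticeSpin.charDist Ω
      (LatticeSpin.cells m (LatticeSpin.badSet Ω Z T d (X m) m)) ∅) atTop (𝓝 0) ∧
    Tendsto (fun m => LatticeSpin.charDist Ω
      (LatticeSpin.cells m (LatticeSpin.boundaryLayer Ω T m)) ∅) atTop (𝓝 0) := by
  obtain ⟨C₁, hC₁, Θ, hΘ, hW⟩ := exists_interface_bound hn hH1 hH2 hX
  choose! W hWC hW using hW
  have hΩm := hΩ_open.measurableSet
  have hint := tendsto_volume_diff_interiorSites hΩ_open hΩ_bdd Θ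
  have hsmall : Tendsto (fun m : ℕ => C₁ / m +
      volume (Ω \ cells m (interiorSites Ω Θ m))) atTop (𝓝 0) := by
    have h1 : Tendsto (fun m : ℕ => C₁ / (m : ℝ≥0∞)) atTop (𝓝 0) := by
      simpa using ENNReal.Tendsto.const_div (a := C₁) ENNReal.tendsto_nat_nhds_top (.inr hC₁)
    simpa using h1.add hint
  have hWvol : ∀ m, 1 ≤ m → volume (cells m (W m)) ≤ C₁ / m := fun m hm =>
    volume_cells_le hm (hWC m hm)
  refine ⟨?_, ?_, ?_⟩
  · let P : Fin k → ℕ → Set (Site n) := fun l j =>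
      phaseSet Ω Z T d (X (2 ^ j)) (2 ^ j) l
    have hP : ∀ l j, SmallInterface Ω Θ C₁ (2 ^ j) (P l j) := fun l j =>
      ⟨W (2 ^ j), hWC _ Nat.one_le_two_pow, fun i hi hiW a =>
        (hW _ Nat.one_le_two_pow i hiW hi).2.2 l a⟩
    have : IsFiniteMeasure (volume.restrict Ω) := ⟨by simpa using hΩ_bdd.measure_lt_top⟩
    obtain ⟨φ, hφ, E, hEm, hlim⟩ := exists_subseq_tendsto_symmDiff
      (μ := volume.restrict Ω) (A := fun l j => cells (2 ^ j) (P l j))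
      (fun l j => measurableSet_cells _ _) fun ε hε => by
        obtain ⟨𝓕, h𝓕, hmeas, hev⟩ :=
          exists_finite_approx hΩ_open hΩ_bdd Θ hC₁ hε
        exact ⟨𝓕, h𝓕, hmeas, fun l => hev.mono fun j hj => hj _ (hP l j)⟩
    have hpow : StrictMono fun j => 2 ^ φ j := (pow_right_strictMono₀ one_lt_two).comp hφ
    have hNm : MeasurableSet (Ω \ ⋃ l, E l) := hΩm.diff (.iUnion hEm)
    have hN : volume (Ω \ ⋃ l, E l) = 0 := by
      have h1 := (hsmall.comp hpow.tendsto_atTop).add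
        (tendsto_finsetSum Finset.univ fun l _ => hlim l)
      rw [Finset.sum_const_zero, add_zero] at h1
      refine le_antisymm (ge_of_tendsto' h1 fun j => ?_) zero_le
      have hm : 1 ≤ 2 ^ φ j := Nat.one_le_two_pow
      have hsub : Ω \ ⋃ l, E l ⊆ (cells (2 ^ φ j) (W (2 ^ φ j)) ∪
          (Ω \ cells (2 ^ φ j) (interiorSites Ω Θ (2 ^ φ j)))) ∪
          ⋃ l ∈ (Finset.univ : Finset (Fin k)),
            symmDiff (cells (2 ^ φ j) (P l (φ j))) (E l) ∩ Ω := by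
        rintro x ⟨hxΩ, hxE⟩
        by_cases hxW : siteOf (2 ^ φ j) x ∈ W (2 ^ φ j)
        · exact .inl (.inl hxW)
        by_cases hxI : siteOf (2 ^ φ j) x ∈ interiorSites Ω Θ (2 ^ φ j)
        · obtain ⟨l, hl⟩ := (hW _ hm _ hxW hxI).1
          exact .inr (Set.mem_iUnion₂.2 ⟨l, Finset.mem_univ l,
            .inl ⟨hl, fun hx => hxE (Set.mem_iUnion.2 ⟨l, hx⟩)⟩, hxΩ⟩)
        · exact .inl (.inr ⟨hxΩ, hxI⟩)
      refine (measure_mono hsub).trans ((measure_union_le _ _).trans (add_le_add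
        ((measure_union_le _ _).trans (add_le_add (hWvol _ hm) le_rfl)) ?_))
      refine (measure_biUnion_finset_le _ _).trans_eq ?_
      simp only [Measure.restrict_apply' hΩm]
    -- The uncovered null set is added to every phase, so that the phases cover `Ω` exactly.
    let E' : Fin k → Set (EuclideanSpace ℝ (Fin n)) := fun l => (E l ∩ Ω) ∪ (Ω \ ⋃ l, E l)
    have hE'm : ∀ l, MeasurableSet (E' l) := fun l => ((hEm l).inter hΩm).union hNm
    have hE'Ω : ∀ l, E' l ⊆ Ω := fun l =>
      Set.union_subset Set.inter_subset_right Set.sdiff_subset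
    have hlim' : ∀ l, Tendsto (fun j => volume.restrict Ω
        (symmDiff (cells (2 ^ φ j) (P l (φ j))) (E' l))) atTop (𝓝 0) := by
      intro l
      refine tendsto_of_tendsto_of_tendsto_of_le_of_le tendsto_const_nhds (hlim l)
        (fun _ => zero_le) fun j => ?_
      simp only [Measure.restrict_apply' hΩm]
      refine (measure_mono (t := (symmDiff (cells (2 ^ φ j) (P l (φ j))) (E l) ∩ Ω) ∪
        (Ω \ ⋃ l, E l)) ?_).trans ((measure_union_le _ _).trans_eq (by rw [hN, add_zero]))
      rintro x ⟨hx, hxΩ⟩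
      simp only [E', Set.mem_symmDiff, Set.mem_union, Set.mem_inter_iff, Set.mem_sdiff] at hx ⊢
      tauto
    refine ⟨fun j => 2 ^ φ j, hpow, E', fun l => ⟨hE'Ω l, hE'm l, ?_⟩, ?_, fun l => ?_⟩
    · exact perimeter_lt_top hΩ_open hΩ_bdd (hE'm l) (hE'Ω l) hC₁ hφ
        (fun j => hP l (φ j)) (hlim' l)
    · refine Set.Subset.antisymm (Set.iUnion_subset hE'Ω) fun x hx => ?_
      by_cases hxE : x ∈ ⋃ l, E l
      · obtain ⟨l, hl⟩ := Set.mem_iUnion.1 hxE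
        exact Set.mem_iUnion.2 ⟨l, .inl ⟨hl, hx⟩⟩
      · rcases isEmpty_or_nonempty (Fin k) with hk | ⟨⟨l⟩⟩
        · -- Without phases the null set `Ω \ ⋃ l, E l` is all of the open set `Ω`.
          rw [Set.iUnion_of_empty, Set.sdiff_empty, hΩ_open.measure_eq_zero_iff volume] at hN
          simp [hN] at hx
        · exact Set.mem_iUnion.2 ⟨l, .inr ⟨hx, hxE⟩⟩
    · refine (hlim' l).congr fun j => ?_
      rw [charDist_eq Ω (measurableSet_cells _ _) (hE'm l)]
  · refine tendsto_of_tendsto_of_tendsto_of_le_of_le' tendsto_const_nhds hsmall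
      (.of_forall fun _ => zero_le) ?_
    filter_upwards [eventually_ge_atTop 1] with m hm
    rw [charDist_eq Ω (measurableSet_cells _ _) .empty,
      Measure.restrict_apply' hΩm]
    refine (measure_mono ?_).trans ((measure_union_le _ _).trans
      (add_le_add (hWvol m hm) le_rfl))
    rintro x ⟨⟨hxb, -⟩ | ⟨hx, -⟩, hxΩ⟩
    swap
    · exact hx.elim
    replace hxb : siteOf m x ∈ badSet Ω Z T d (X m) m := hxb
    by_cases hxW : siteOf m x ∈ W m
    · exact .inl hxW
    · exact .inr ⟨hxΩ, fun hxI => (hW m hm _ hxW hxI).2.1 hxb⟩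
  · refine tendsto_of_tendsto_of_tendsto_of_le_of_le tendsto_const_nhds hint
      (fun _ => zero_le) fun m => ?_
    rw [charDist_eq Ω (measurableSet_cells _ _) .empty,
      Measure.restrict_apply' hΩm]
    refine measure_mono ?_
    rintro x ⟨⟨hxb, -⟩ | ⟨hx, -⟩, hxΩ⟩
    swap
    · exact hx.elim
    replace hxb : siteOf m x ∈ boundaryLayer Ω T m := hxb
    obtain ⟨-, j, hj, hjΩ⟩ := hxb
    refine ⟨hxΩ, fun hxI => hjΩ ?_⟩
    have := hxI (j - siteOf m x) (hΘ (mem_tau.1 hj))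
    change siteOf m x + (j - siteOf m x) ∈ hatΩ Ω m at this
    rwa [add_sub_cancel] at this
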